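/- Let $n\ge 0$. A polyhedral cone in $\mathbb R^n$ is the intersection of a finite (possibly empty) family of closed halfspaces with the origin in their boundary; $\mathcal{PC}^n$ is the set of all polyhedral cones, and $\mathsf U(\mathcal{PC}^n)$ is the set of all finite unions of polyhedral cones, together with $\emptyset$. A polyhedron is a finite (possibly empty) union of compact convex polytopes. A real function $\varphi$ on a family $\mathcal S$ of sets is a valuation if $\varphi(A\cup B)+\varphi(A\cap B)=\varphi(A)+\varphi(B)$ whenever $A,B,A\cup B,A\cap B\in\mathcal S$, and $\varphi(\emptyset)=0$ if $\emptyset\in\mathcal S$. For $C\in\mathcal{PC}^n$ let $C^\circ=\{x:\langle x,y\rangle\le 0\text{ for all }y\in C\}$. For a polyhedron $P$ and $x\in\mathbb R^n$ let $\mathrm{Tan}(P,x)=\{v: [x,x+\lambda v]\subseteq P\text{ for some }\lambda>0\}$, where $[a,b]$ is the closed segment with endpoints $a,b$. The Euler characteristic $\chi(P)$ of a polyhedron is $\sum_{s}(-1)^{\dim s}$, summed over the simplices $s$ of any finite simplicial complex with underlying set $P$; such complexes exist, and the sum does not depend on the choice. **Theorem 1.** Let $\varphi$ be a valuation on $\mathcal{PC}^n$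 with $\varphi(\mathbb R^n)=1$ that is simple, i.e. $\varphi(C)=0$ for all $C\in\mathcal{PC}^n$ with $\dim C<n$. Then the function $C\mapsto\varphi(C^\circ)$ on $\mathcal{PC}^n$ has an extension to a valuation on $\mathsf U(\mathcal{PC}^n)$. For every such extension $\varphi^\circ$, define, for polyhedra $P$ and points $x\in\mathbb R^n$, $$\kappa(P,x)=\varphi^\circ(\mathrm{Tan}(P,x))\ \text{ if }x\in P,\qquad \kappa(P,x)=0\ \text{ if }x\notin P.$$ Then $\kappa$ is a polyhedral vertex curvature, that is: 1. if $N$ is a neighborhood of $x$ and $P,Q$ are polyhedra with $P\cap N=Q\cap N$, then $\kappa(P,x)=\kappa(Q,x)$; 2. for each polyhedron $P$, $\kappa(P,x)\ne0$ for only finitely many $x\in P$, and $\sum_{x\in P}\kappa(P,x)=\chi(P)$. -/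

import Mathlib

/-- `n`-dimensional Euclidean space. -/
abbrev Euc (n : ℕ) : Type := EuclideanSpace ℝ (Fin n)

section Valuations

variable {X : Type*}

/-- `φ` is additive (a valuation) on the family `S` of sets; only the values of `φ` on members of
`S` matter. -/
structure IsValuationOn (S : Set (Set X)) (φ : Set X → ℝ) : Prop where
  additive : ∀ A ∈ S, ∀ B ∈ S, A ∪ B ∈ S → φ (A ∪ B) + φ (A ∩ B) = φ A + φ B
  empty : ∅ ∈ S → φ ∅ = 0

/-- The family of all finite unions of members of `S`, including the empty set. -/
def finiteUnions (S : Set (Set X)) : Set (Set X) :=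
  {A | ∃ F : Set (Set X), F.Finite ∧ F ⊆ S ∧ A = ⋃₀ F}

/-- `ψ` restricts to an additive extension of `φ : S → ℝ` to the finite unions of members
of `S`. -/
structure IsAdditiveExtension (S : Set (Set X)) (φ ψ : Set X → ℝ) : Prop where
  valuation : IsValuationOn (finiteUnions S) ψ
  extends_on : ∀ A ∈ S, ψ A = φ A

end Valuations

section Families

/-- Convex polytopes (convex hulls of finitely many points), together with the empty set. -/
def polytopes (n : ℕ) : Set (Set (Euc n)) :=
  {P | ∃ V : Set (Euc n), V.Finite ∧ P = convexHull ℝ V}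

/-- Polyhedra: finite unions of convex polytopes. -/
def polyhedra (n : ℕ) : Set (Set (Euc n)) :=
  finiteUnions (polytopes n)

/-- Polyhedral cones: intersections of finite, possibly empty, families of closed halfspaces
with the origin in the boundary. -/
def polyhedralCones (n : ℕ) : Set (Set (Euc n)) :=
  {C | ∃ U : Set (Euc n), U.Finite ∧ (∀ u ∈ U, u ≠ 0) ∧ C = {x | ∀ u ∈ U, inner ℝ x u ≤ 0}}

/-- The dual cone `{x | ⟨x, y⟩ ≤ 0 for all y ∈ C}`. -/
def dualCone {n : ℕ} (C : Set (Euc n)) : Set (Euc n) :=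
  {x | ∀ y ∈ C, inner ℝ x y ≤ 0}

/-- `φ` vanishes on polyhedral cones of dimension less than `n`. A cone contains the origin, so
its dimension is that of its linear span. -/
def IsSimple (n : ℕ) (φ : Set (Euc n) → ℝ) : Prop :=
  ∀ C ∈ polyhedralCones n, Module.finrank ℝ (Submodule.span ℝ C) < n → φ C = 0

/-- The dual valuation `C ↦ φ (C°)`. -/
def dualValuation {n : ℕ} (φ : Set (Euc n) → ℝ) : Set (Euc n) → ℝ :=
  fun C => φ (dualCone C)

/-- The tangent cone: all `v` such that the segment from `x` to `x + t v` lies in `P` for some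
`t > 0`. -/
def tanCone {n : ℕ} (P : Set (Euc n)) (x : Euc n) : Set (Euc n) :=
  {v | ∃ t : ℝ, 0 < t ∧ segment ℝ x (x + t • v) ⊆ P}

end Families

section Euler

/-- `K` is a finite geometric simplicial complex with underlying space `P`. -/
def IsTriangulation {n : ℕ} (K : Geometry.SimplicialComplex ℝ (Euc n)) (P : Set (Euc n)) : Prop :=
  K.faces.Finite ∧ K.space = P

/-- The alternating sum `∑ (-1) ^ dim s` over the simplices `s` of `K`. A simplex with `k`
vertices has dimension `k - 1`, and `(-1) ^ (k - 1) = (-1) ^ (k + 1)`. -/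
noncomputable def complexEulerChar {n : ℕ} (K : Geometry.SimplicialComplex ℝ (Euc n)) : ℤ :=
  ∑ᶠ s ∈ K.faces, (-1 : ℤ) ^ (s.card + 1)

/-- `c` is the Euler characteristic of the polyhedron `P`: the set `P` has a finite
triangulation, and the alternating sum of the numbers of simplices of every finite triangulation
of `P` is `c`. At most one `c` satisfies this. -/
structure IsEulerChar {n : ℕ} (P : Set (Euc n)) (c : ℝ) : Prop where
  triangulable : ∃ K : Geometry.SimplicialComplex ℝ (Euc n), IsTriangulation K P
  eq_complexEulerChar : ∀ K : Geometry.SimplicialComplex ℝ (Euc n), IsTriangulation K P →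
    c = (complexEulerChar K : ℝ)

end Euler

/-- Polyhedral vertex curvatures; only the values `κ P x` at polyhedra `P` matter. -/
structure IsPolyhedralVertexCurvature (n : ℕ) (κ : Set (Euc n) → Euc n → ℝ) : Prop where
  /-- If `N` is a neighborhood of `x`, then `κ P x` depends only on `P ∩ N`. -/
  isLocal : ∀ x : Euc n, ∀ N ∈ nhds x, ∀ P ∈ polyhedra n, ∀ Q ∈ polyhedra n,
    P ∩ N = Q ∩ N → κ P x = κ Q x
  finite_support : ∀ P ∈ polyhedra n, {x | x ∈ P ∧ κ P x ≠ 0}.Finite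
  /-- The sum of the curvatures over the points of `P` is the Euler characteristic. -/
  sum_eq : ∀ P ∈ polyhedra n, IsEulerChar P (∑ᶠ x ∈ P, κ P x)

open Classical in
/-- The function equal to `ψ (Tan (P, x))` for `x ∈ P`, and to `0` otherwise. -/
noncomputable def vertexCurvature {n : ℕ} (ψ : Set (Euc n) → ℝ) (P : Set (Euc n)) (x : Euc n) :
    ℝ :=
  if x ∈ P then ψ (tanCone P x) else 0

/-!
The argument treats a simple valuation `φ` on polyhedral cones as a finitely additive measure and
integrates a statement about a single linear functional `u`.

Cutting by hyperplanes shows that, on finitely many cones, `φ` is a weighted count of the chambers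
of a hyperplane arrangement, so that it respects every linear relation between indicators of cones
that holds off finitely many hyperplanes (`IsValuationOn.sum_eq_zero_of_generic`). Linear relations
between indicators of cones pass to the dual cones (`sum_indicator_dualCone_eq_zero`), by means of
the Euler functional on compact convex sets, and dual cones are polyhedral by Weyl's theorem. Hence
`C ↦ φ (C°)` is induced by a linear functional on functions, evaluated at indicators
(`IsValuationOn.exists_linearMap_dualValuation`). This gives an extension to finite unions, and all
extensions agree with it (`IsAdditiveExtension.eq_linearMap`).

For a polyhedron triangulated by a complex `K`, Möbius inversion writes the indicator of the
polyhedron as `∑ c s • 1_s` over the closed simplices `s` of `K`, and `∑ c s` is the alternating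
sum that defines the Euler characteristic (`sum_indicator_faceCoeff`, `sum_faceCoeff`). The relation
passes to tangent cones (`indicator_tanCone_eq_sum`), so that the curvature at `x` is
`∑ c s * φ (N (s, x))`, where `N (s, x)` is the normal cone of `s` at `x`. If `x` is not a vertex of
`s`, then `N (s, x)` is not full-dimensional, and the normal cones at the vertices of `s` tile the
space, so that `∑ v ∈ s, φ (N (s, v)) = 1` (`IsValuationOn.sum_normalCone`). Summation over `x`
therefore gives `∑ c s`. As this holds for every triangulation `K`, the independence of the
alternating sum of the triangulation is a consequence and not an ingredient.

Triangulations exist (`exists_isTriangulation`): the hyperplanes that bound the given polytopes cut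
the polyhedron into cells, and after a center has been chosen in each cell, the chains of cells
form a triangulation, as in barycentric subdivision.
-/

/-! ### Finitely generated cones are polyhedral -/

/-- The convex cone generated by a finite set. -/
def finCone {V : Type*} [AddCommGroup V] [Module ℝ V] (s : Finset V) : Set V :=
  {x | ∃ c : V → ℝ, (∀ v ∈ s, 0 ≤ c v) ∧ ∑ v ∈ s, c v • v = x}

lemma mem_finCone_insert {V : Type*} [AddCommGroup V] [Module ℝ V] [DecidableEq V] {w : V}
    {s : Finset V} (hw : w ∉ s) {x : V} :
    x ∈ finCone (insert w s) ↔ ∃ t : ℝ, 0 ≤ t ∧ x - t • w ∈ finCone s := by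
  constructor
  · rintro ⟨c, hc, rfl⟩
    refine ⟨c w, hc w (by simp), c, fun v hv => hc v (by simp [hv]), ?_⟩
    rw [Finset.sum_insert hw]
    abel
  · rintro ⟨t, ht, c, hc, h⟩
    refine ⟨fun v => if v = w then t else c v, ?_, ?_⟩
    · intro v hv
      dsimp only
      split_ifs with hvw
      · exact ht
      · exact hc v (by simpa [hvw] using hv)
    · rw [Finset.sum_insert hw]
      dsimp only
      rw [if_pos rfl]
      have : ∑ v ∈ s, (if v = w then t else c v) • v = ∑ v ∈ s, c v • v :=
        Finset.sum_congr rfl fun v hv => by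
          rw [if_neg (ne_of_mem_of_not_mem hv hw)]
      rw [this, h]
      abel

/-- Fourier–Motzkin elimination: the Minkowski sum of a polyhedral cone and a ray is polyhedral. -/
lemma exists_finset_dual_add_ray {V : Type*} [AddCommGroup V] [Module ℝ V]
    (L : Finset (Module.Dual ℝ V)) (w : V) :
    ∃ L' : Finset (Module.Dual ℝ V), ∀ x : V,
      (∃ t : ℝ, 0 ≤ t ∧ ∀ f ∈ L, f (x - t • w) ≤ 0) ↔ ∀ f ∈ L', f x ≤ 0 := by
  classical
  refine ⟨(L.filter fun f => f w ≤ 0) ∪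
    ((L.filter fun f => 0 < f w) ×ˢ (L.filter fun f => f w < 0)).image
      (fun p => p.1 w • p.2 - p.2 w • p.1), fun x => ⟨?_, ?_⟩⟩
  · rintro ⟨t, ht, h⟩ f hf
    simp only [Finset.mem_union, Finset.mem_filter, Finset.mem_image, Finset.mem_product,
      Prod.exists] at hf
    rcases hf with ⟨hf, hfw⟩ | ⟨f, g, ⟨⟨hf, hfw⟩, hg, hgw⟩, rfl⟩
    · have := h f hf
      simp only [map_sub, map_smul, smul_eq_mul] at this
      nlinarith
    · have h1 := h f hf
      have h2 := h g hg
      simp only [map_sub, map_smul, smul_eq_mul, LinearMap.sub_apply, LinearMap.smul_apply]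
        at h1 h2 ⊢
      nlinarith
  · intro h
    have h1 : ∀ f ∈ L, f w ≤ 0 → f x ≤ 0 := fun f hf hfw =>
      h f (by simp [hf, hfw])
    have h2 : ∀ f ∈ L, 0 < f w → ∀ g ∈ L, g w < 0 → f w * g x - g w * f x ≤ 0 := by
      intro f hf hfw g hg hgw
      have := h (f w • g - g w • f) (by
        simp only [Finset.mem_union, Finset.mem_image, Finset.mem_product, Finset.mem_filter]
        exact Or.inr ⟨(f, g), ⟨⟨hf, hfw⟩, hg, hgw⟩, rfl⟩)
      simpa using this
    set A : Finset ℝ := insert 0 ((L.filter fun f => 0 < f w).image fun f => f x / f w) with hA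
    have hne : A.Nonempty := ⟨0, by simp [hA]⟩
    have ht0 : 0 ≤ A.max' hne := A.le_max' _ (by simp [hA])
    refine ⟨A.max' hne, ht0, fun f hf => ?_⟩
    simp only [map_sub, map_smul, smul_eq_mul]
    rcases lt_trichotomy (f w) 0 with hfw | hfw | hfw
    · rcases Finset.mem_insert.1 (A.max'_mem hne) with h0 | hmem
      · rw [h0]
        linarith [h1 f hf hfw.le]
      · obtain ⟨g, hg, hgA⟩ := Finset.mem_image.1 hmem
        rw [Finset.mem_filter] at hg
        have h3 := h2 g hg.1 hg.2 f hf hfw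
        rw [← hgA]
        have h4 : f x - g x / g w * f w = (g w * f x - f w * g x) / g w := by
          have := hg.2.ne'
          field_simp
        rw [h4]
        exact div_nonpos_of_nonpos_of_nonneg h3 hg.2.le
    · rw [hfw, mul_zero, sub_zero]
      exact h1 f hf hfw.le
    · have h3 : f x / f w ≤ A.max' hne :=
        A.le_max' _ (by
          rw [hA, Finset.mem_insert]
          exact Or.inr (Finset.mem_image.2 ⟨f, by simp [hf, hfw], rfl⟩))
      rw [div_le_iff₀ hfw] at h3
      linarith

/-- Weyl's theorem: a finitely generated cone is the solution set of finitely many homogeneous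
linear inequalities. -/
lemma exists_finset_dual_finCone {V : Type*} [AddCommGroup V] [Module ℝ V]
    [FiniteDimensional ℝ V] (s : Finset V) :
    ∃ L : Finset (Module.Dual ℝ V), ∀ x, x ∈ finCone s ↔ ∀ f ∈ L, f x ≤ 0 := by
  classical
  induction s using Finset.induction_on with
  | empty =>
    let b := Module.finBasis ℝ V
    refine ⟨Finset.univ.image (fun i => b.coord i) ∪ Finset.univ.image (fun i => -b.coord i),
      fun x => ⟨?_, fun h => ?_⟩⟩
    · rintro ⟨c, -, rfl⟩
      simp
    · refine ⟨0, by simp, ?_⟩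
      rw [Finset.sum_empty]
      refine (b.ext_elem fun i => ?_).symm
      have h1 := h (b.coord i) (by simp)
      have h2 := h (-b.coord i) (by simp)
      simp only [LinearMap.neg_apply, Module.Basis.coord_apply] at h1 h2
      rw [map_zero, Finsupp.zero_apply]
      linarith
  | insert w s hw ih =>
    obtain ⟨L, hL⟩ := ih
    obtain ⟨L', hL'⟩ := exists_finset_dual_add_ray L w
    refine ⟨L', fun x => ?_⟩
    rw [mem_finCone_insert hw, ← hL']
    simp only [hL]

section PolyhedralCones

variable {n : ℕ}

/-- Zero normals may be discarded, as they impose no condition. -/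
lemma setOf_inner_nonpos_mem_polyhedralCones (U : Finset (Euc n)) :
    {x : Euc n | ∀ u ∈ U, inner ℝ x u ≤ 0} ∈ polyhedralCones n := by
  classical
  refine ⟨↑(U.filter fun u => u ≠ 0), Finset.finite_toSet _, by simp, ?_⟩
  ext x
  simp only [Set.mem_ofPred_eq, Finset.coe_filter]
  refine ⟨fun h u hu => h u hu.1, fun h u hu => ?_⟩
  by_cases h0 : u = 0
  · simp [h0]
  · exact h u ⟨hu, h0⟩

lemma exists_finset_of_mem_polyhedralCones {C : Set (Euc n)} (hC : C ∈ polyhedralCones n) :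
    ∃ U : Finset (Euc n), (∀ u ∈ U, u ≠ 0) ∧ C = {x | ∀ u ∈ U, inner ℝ x u ≤ 0} := by
  obtain ⟨U, hU, h0, rfl⟩ := hC
  exact ⟨hU.toFinset, by simpa using h0, by simp⟩

lemma inter_mem_polyhedralCones {C D : Set (Euc n)} (hC : C ∈ polyhedralCones n)
    (hD : D ∈ polyhedralCones n) : C ∩ D ∈ polyhedralCones n := by
  classical
  obtain ⟨U, hU, h0, rfl⟩ := hC
  obtain ⟨W, hW, h1, rfl⟩ := hD
  refine ⟨U ∪ W, hU.union hW, ?_, ?_⟩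
  · rintro u (hu | hu)
    exacts [h0 u hu, h1 u hu]
  · ext x
    simp only [Set.mem_inter_iff, Set.mem_ofPred_eq, Set.mem_union]
    grind

lemma zero_mem_of_mem_polyhedralCones {C : Set (Euc n)} (hC : C ∈ polyhedralCones n) :
    (0 : Euc n) ∈ C := by
  obtain ⟨U, -, -, rfl⟩ := hC
  simp

/-- Weyl's theorem in Euclidean space, functionals being represented by inner products. -/
lemma finCone_eq_setOf_inner (s : Finset (Euc n)) :
    ∃ U : Finset (Euc n), finCone s = {x | ∀ u ∈ U, inner ℝ x u ≤ 0} := by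
  classical
  obtain ⟨L, hL⟩ := exists_finset_dual_finCone s
  refine ⟨L.image fun f => (InnerProductSpace.toDual ℝ (Euc n)).symm
    (LinearMap.toContinuousLinearMap f), ?_⟩
  ext x
  simp only [hL, Set.mem_ofPred_eq, Finset.forall_mem_image]
  refine forall₂_congr fun f _ => ?_
  rw [real_inner_comm, InnerProductSpace.toDual_symm_apply]
  rfl

lemma finCone_mem_polyhedralCones (s : Finset (Euc n)) : finCone s ∈ polyhedralCones n := by
  obtain ⟨U, hU⟩ := finCone_eq_setOf_inner s
  exact hU ▸ setOf_inner_nonpos_mem_polyhedralCones U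

lemma subset_finCone (s : Finset (Euc n)) : (s : Set (Euc n)) ⊆ finCone s := by
  classical
  intro v hv
  refine ⟨fun u => if u = v then 1 else 0, fun u _ => by positivity, ?_⟩
  simp only [ite_smul, one_smul, zero_smul]
  rw [Finset.sum_ite_eq' s v, if_pos (by simpa using hv)]

lemma dualCone_finCone (s : Finset (Euc n)) :
    dualCone (finCone s) = {x | ∀ v ∈ s, inner ℝ x v ≤ 0} := by
  ext x
  refine ⟨fun h v hv => h v (subset_finCone s hv), ?_⟩
  rintro h _ ⟨c, hc, rfl⟩
  rw [inner_sum]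
  refine Finset.sum_nonpos fun v hv => ?_
  rw [inner_smul_right]
  exact mul_nonpos_of_nonneg_of_nonpos (hc v hv) (h v hv)

/-- The dual of a polyhedral cone is generated by the normals of its defining halfspaces. -/
lemma dualCone_setOf_inner (U : Finset (Euc n)) :
    dualCone {x : Euc n | ∀ u ∈ U, inner ℝ x u ≤ 0} = finCone U := by
  refine Set.Subset.antisymm (fun x hx => ?_) ?_
  · obtain ⟨W, hW⟩ := finCone_eq_setOf_inner U
    rw [hW]
    intro w hw
    refine hx w fun u hu => ?_
    have hu' : u ∈ finCone U := subset_finCone U hu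
    rw [hW] at hu'
    rw [real_inner_comm]
    exact hu' w hw
  · intro x hx y hy
    rw [← dualCone_finCone] at hy
    rw [real_inner_comm]
    exact hy x hx

lemma dualCone_mem_polyhedralCones {C : Set (Euc n)} (hC : C ∈ polyhedralCones n) :
    dualCone C ∈ polyhedralCones n := by
  obtain ⟨U, -, rfl⟩ := exists_finset_of_mem_polyhedralCones hC
  rw [dualCone_setOf_inner]
  exact finCone_mem_polyhedralCones U

end PolyhedralCones

/-! ### The Euler functional on compact convex sets and polarity -/

/-- The sum of the coefficients of the intervals with right end `t` is the jump
`f t - f (t + δ)` of the combination `f` of indicators at `t`. -/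
lemma sum_eq_zero_of_sum_indicator_Icc {ι : Type*} (I : Finset ι) (a l r : ι → ℝ)
    (hlr : ∀ i ∈ I, l i ≤ r i)
    (h : ∀ t, ∑ i ∈ I, (Set.Icc (l i) (r i)).indicator (fun _ => a i) t = 0) :
    ∑ i ∈ I, a i = 0 := by
  classical
  have key : ∀ t, ∑ i ∈ I with r i = t, a i = 0 := by
    intro t
    have hev : ∀ᶠ s in nhdsWithin t (Set.Ioi t),
        t < s ∧ ∀ i ∈ I, (t < l i → s < l i) ∧ (t < r i → s < r i) := by
      refine Filter.Eventually.and self_mem_nhdsWithin ?_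
      rw [Filter.eventually_all_finset]
      refine fun i _ => Filter.Eventually.and ?_ ?_
      · by_cases hi : t < l i
        · filter_upwards [nhdsWithin_le_nhds (Iio_mem_nhds hi)] with s hs _ using hs
        · simp [hi]
      · by_cases hi : t < r i
        · filter_upwards [nhdsWithin_le_nhds (Iio_mem_nhds hi)] with s hs _ using hs
        · simp [hi]
    obtain ⟨s, hts, hs⟩ := hev.exists
    have h1 := h t
    have h2 := h s
    refine Eq.trans ?_ (sub_eq_zero.2 (h1.trans h2.symm))
    rw [Finset.sum_filter, ← Finset.sum_sub_distrib]
    refine Finset.sum_congr rfl fun i hi => ?_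
    have h3 := hs i hi
    have h4 := hlr i hi
    simp only [Set.indicator_apply, Set.mem_Icc]
    rcases lt_trichotomy (r i) t with hr | hr | hr
    · rw [if_neg hr.ne, if_neg (fun h => by linarith [h.2]), if_neg (fun h => by linarith [h.2]),
        sub_zero]
    · rw [if_pos hr, if_pos ⟨by linarith, hr.ge⟩, if_neg (fun h => by linarith [h.2]), sub_zero]
    · rw [if_neg hr.ne']
      by_cases hl : l i ≤ t
      · rw [if_pos ⟨hl, hr.le⟩, if_pos ⟨by linarith, (h3.2 hr).le⟩, sub_self]
      · rw [if_neg (fun h => hl h.1),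
          if_neg (fun h => by linarith [h.1, h3.1 (not_le.1 hl)]), sub_self]
  rw [← Finset.sum_fiberwise_of_maps_to (t := I.image r)
    (fun i hi => Finset.mem_image_of_mem r hi)]
  exact Finset.sum_eq_zero fun t _ => key t

/-- A linear relation between indicators of compact convex sets forces the same relation between
their Euler characteristics, which are `1` for nonempty sets and `0` for `∅`. The proof slices by
the level sets of the functionals in `L`, one functional at a time, so no coordinates on the
slices are needed. -/
lemma sum_nonempty_eq_zero_of_separating {E : Type*} [NormedAddCommGroup E] [NormedSpace ℝ E]
    {ι : Type*} (L : Finset (E →L[ℝ] ℝ)) : ∀ (I : Finset ι) (a : ι → ℝ) (K : ι → Set E),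
    (∀ i ∈ I, IsCompact (K i)) → (∀ i ∈ I, Convex ℝ (K i)) →
    (∀ i ∈ I, ∀ j ∈ I, ∀ x ∈ K i, ∀ y ∈ K j, (∀ f ∈ L, f x = f y) → x = y) →
    (∀ x, ∑ i ∈ I, (K i).indicator (fun _ => a i) x = 0) →
    ∑ i ∈ I, {i | (K i).Nonempty}.indicator a i = 0 := by
  classical
  induction L using Finset.induction_on with
  | empty =>
    intro I a K _ _ hsep h
    by_cases hne : ∃ i ∈ I, (K i).Nonempty
    · obtain ⟨j, hj, p, hp⟩ := hne
      rw [← h p]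
      refine Finset.sum_congr rfl fun i hi => ?_
      simp only [Set.indicator_apply, Set.mem_ofPred_eq]
      congr 1
      refine propext ⟨fun ⟨x, hx⟩ => ?_, fun hp => ⟨p, hp⟩⟩
      rwa [hsep j hj i hi p hp x hx (by simp)]
    · push Not at hne
      refine Finset.sum_eq_zero fun i hi => Set.indicator_of_notMem ?_ _
      simp [hne i hi]
  | insert f L hf ih =>
    intro I a K hcomp hconv hsep h
    have hsum : ∑ i ∈ I, {i | (K i).Nonempty}.indicator a i
        = ∑ i ∈ I with (K i).Nonempty, a i := by
      rw [Finset.sum_filter]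
      rfl
    rw [hsum]
    have hIcc : ∀ i ∈ I, (K i).Nonempty →
        f '' K i = Set.Icc (sInf (f '' K i)) (sSup (f '' K i)) := fun i hi hne =>
      eq_Icc_of_connected_compact
        ⟨hne.image f, (hconv i hi).isPreconnected.image f f.continuous.continuousOn⟩
        ((hcomp i hi).image f.continuous)
    refine sum_eq_zero_of_sum_indicator_Icc _ a (fun i => sInf (f '' K i))
      (fun i => sSup (f '' K i)) ?_ ?_
    · intro i hi
      rw [Finset.mem_filter] at hi
      have h1 := hi.2.image f
      rw [hIcc i hi.1 hi.2] at h1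
      exact Set.nonempty_Icc.1 h1
    · intro t
      have h1 := ih I a (fun i => K i ∩ f ⁻¹' {t})
        (fun i hi => (hcomp i hi).inter_right (isClosed_singleton.preimage f.continuous))
        (fun i hi => (hconv i hi).inter ((convex_singleton t).linear_preimage f.toLinearMap))
        (fun i hi j hj x hx y hy hxy => hsep i hi j hj x hx.1 y hy.1 fun g hg => by
          rcases Finset.mem_insert.1 hg with rfl | hg
          · exact hx.2.trans hy.2.symm
          · exact hxy g hg)
        (fun x => by
          by_cases hx : f x = t
          · rw [← h x]
            refine Finset.sum_congr rfl fun i _ => ?_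
            simp [Set.indicator_apply, hx]
          · refine Finset.sum_eq_zero fun i _ => Set.indicator_of_notMem ?_ _
            simp [hx])
      rw [← h1, Finset.sum_filter]
      refine Finset.sum_congr rfl fun i hi => ?_
      simp only [Set.indicator_apply, Set.mem_ofPred_eq]
      by_cases hne : (K i).Nonempty
      · rw [if_pos hne]
        refine if_congr ?_ rfl rfl
        rw [← hIcc i hi hne]
        rfl
      · rw [Set.not_nonempty_iff_eq_empty] at hne
        simp [hne]

lemma sum_nonempty_eq_zero_of_sum_indicator {n : ℕ} {ι : Type*} (I : Finset ι) (a : ι → ℝ)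
    (K : ι → Set (Euc n)) (hcomp : ∀ i ∈ I, IsCompact (K i)) (hconv : ∀ i ∈ I, Convex ℝ (K i))
    (h : ∀ x, ∑ i ∈ I, (K i).indicator (fun _ => a i) x = 0) :
    ∑ i ∈ I, {i | (K i).Nonempty}.indicator a i = 0 := by
  classical
  refine sum_nonempty_eq_zero_of_separating
    (Finset.univ.image fun i : Fin n => EuclideanSpace.proj (𝕜 := ℝ) i) I a K hcomp hconv ?_ h
  intro i _ j _ x _ y _ hxy
  ext k
  exact hxy (EuclideanSpace.proj k) (by simp)

section Polarity

variable {n : ℕ}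

lemma isClosed_of_mem_polyhedralCones {C : Set (Euc n)} (hC : C ∈ polyhedralCones n) :
    IsClosed C := by
  obtain ⟨U, -, -, rfl⟩ := hC
  simp only [Set.ofPred_forall]
  exact isClosed_biInter fun u _ => isClosed_le (by fun_prop) continuous_const

lemma convex_of_mem_polyhedralCones {C : Set (Euc n)} (hC : C ∈ polyhedralCones n) :
    Convex ℝ C := by
  obtain ⟨U, -, -, rfl⟩ := hC
  intro x hx y hy s t hs ht _ u hu
  rw [inner_add_left, real_inner_smul_left, real_inner_smul_left]
  nlinarith [hx u hu, hy u hu]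

lemma smul_mem_of_mem_polyhedralCones {C : Set (Euc n)} (hC : C ∈ polyhedralCones n) {t : ℝ}
    (ht : 0 ≤ t) {x : Euc n} (hx : x ∈ C) : t • x ∈ C := by
  obtain ⟨U, -, -, rfl⟩ := hC
  intro u hu
  rw [real_inner_smul_left]
  exact mul_nonpos_of_nonneg_of_nonpos ht (hx u hu)

/-- Linear relations between indicators of polyhedral cones pass to the dual cones. For small
`ε > 0` the truncation `{y ∈ C | ‖y‖ ≤ 1, ε ≤ ⟪u, y⟫}` is empty exactly if `u ∈ C°`, and
truncation preserves linear relations, as does the Euler characteristic. -/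
lemma sum_indicator_dualCone_eq_zero {ι : Type*} (I : Finset ι) (a : ι → ℝ)
    (C : ι → Set (Euc n)) (hC : ∀ i ∈ I, C i ∈ polyhedralCones n)
    (h : ∀ x, ∑ i ∈ I, (C i).indicator (fun _ => a i) x = 0) (u : Euc n) :
    ∑ i ∈ I, (dualCone (C i)).indicator (fun _ => a i) u = 0 := by
  classical
  set K : ℝ → ι → Set (Euc n) := fun ε i =>
    C i ∩ (Metric.closedBall 0 1 ∩ {y | ε ≤ inner ℝ u y}) with hK
  have hev : ∀ᶠ ε in nhdsWithin (0 : ℝ) (Set.Ioi 0),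
      ∀ i ∈ I, (K ε i).Nonempty ↔ u ∉ dualCone (C i) := by
    rw [Filter.eventually_all_finset]
    intro i hi
    by_cases hu : u ∈ dualCone (C i)
    · filter_upwards [self_mem_nhdsWithin] with ε hε
      refine iff_of_false ?_ (not_not.2 hu)
      rintro ⟨y, hyC, -, hy⟩
      exact absurd (hu y hyC) (not_le.2 (lt_of_lt_of_le hε hy))
    · have hu' : ∃ y ∈ C i, 0 < inner ℝ u y := by
        by_contra! hcon
        exact hu hcon
      obtain ⟨y, hyC, hy⟩ := hu'
      have hy0 : 0 < ‖y‖ := by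
        rw [norm_pos_iff]
        rintro rfl
        simp at hy
      have hpos : 0 < ‖y‖⁻¹ * inner ℝ u y := by positivity
      filter_upwards [nhdsWithin_le_nhds (Iic_mem_nhds hpos)] with ε hε
      refine iff_of_true ⟨‖y‖⁻¹ • y, smul_mem_of_mem_polyhedralCones (hC i hi) (by positivity) hyC,
        ?_, ?_⟩ hu
      · rw [mem_closedBall_zero_iff, norm_smul, norm_inv, norm_norm, inv_mul_cancel₀ hy0.ne']
      · rw [Set.mem_ofPred_eq, real_inner_smul_right]
        exact hε
  obtain ⟨ε, hε⟩ := hev.exists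
  have h1 := sum_nonempty_eq_zero_of_sum_indicator I a (K ε)
    (fun i hi => (((isCompact_closedBall _ _).inter_right
      (isClosed_le continuous_const (by fun_prop))).inter_left
        (isClosed_of_mem_polyhedralCones (hC i hi))))
    (fun i hi => (convex_of_mem_polyhedralCones (hC i hi)).inter
      ((convex_closedBall _ _).inter (convex_halfSpace_ge
        ((innerₗ (Euc n) u).isLinear) ε)))
    (fun x => by
      by_cases hx : x ∈ Metric.closedBall 0 1 ∩ {y | ε ≤ inner ℝ u y}
      · rw [← h x]
        refine Finset.sum_congr rfl fun i _ => ?_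
        rw [Set.indicator_apply, Set.indicator_apply]
        exact if_congr (and_iff_left hx) rfl rfl
      · exact Finset.sum_eq_zero fun i _ => Set.indicator_of_notMem (fun h => hx h.2) _)
  have h2 : ∑ i ∈ I, a i = 0 := by
    rw [← h 0]
    refine Finset.sum_congr rfl fun i hi => ?_
    rw [Set.indicator_of_mem (zero_mem_of_mem_polyhedralCones (hC i hi))]
  have h3 : ∑ i ∈ I, (dualCone (C i)).indicator (fun _ => a i) u
      = ∑ i ∈ I, a i - ∑ i ∈ I, {i | (K ε i).Nonempty}.indicator a i := by
    rw [← Finset.sum_sub_distrib]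
    refine Finset.sum_congr rfl fun i hi => ?_
    simp only [Set.indicator_apply, Set.mem_ofPred_eq, hε i hi]
    split_ifs <;> simp_all
  rw [h3, h1, h2, sub_zero]

end Polarity

/-! ### Full additivity of simple valuations on cones -/

section SimpleValuations

variable {n : ℕ} {φ : Set (Euc n) → ℝ}

lemma IsSimple.eq_zero_of_subset_hyperplane (hsimple : IsSimple n φ) {C : Set (Euc n)}
    (hC : C ∈ polyhedralCones n) {a : Euc n} (ha : a ≠ 0) (h : ∀ x ∈ C, inner ℝ x a = 0) :
    φ C = 0 := by
  refine hsimple C hC ?_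
  have hlt : Submodule.span ℝ C < ⊤ := by
    refine lt_top_iff_ne_top.2 fun htop => ha ?_
    have hle : Submodule.span ℝ C ≤ (ℝ ∙ a)ᗮ :=
      Submodule.span_le.2 fun x hx => by
        rw [SetLike.mem_coe, Submodule.mem_orthogonal_singleton_iff_inner_left]
        exact h x hx
    have ha' : a ∈ (ℝ ∙ a)ᗮ := hle (htop ▸ Submodule.mem_top)
    rw [Submodule.mem_orthogonal_singleton_iff_inner_left] at ha'
    exact inner_self_eq_zero.1 ha'
  simpa using Submodule.finrank_lt_finrank_of_lt hlt

lemma setOf_inner_nonpos_mem (a : Euc n) : {x : Euc n | inner ℝ x a ≤ 0} ∈ polyhedralCones n := by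
  simpa using setOf_inner_nonpos_mem_polyhedralCones {a}

lemma setOf_inner_nonneg_mem (a : Euc n) : {x : Euc n | 0 ≤ inner ℝ x a} ∈ polyhedralCones n := by
  simpa using setOf_inner_nonpos_mem_polyhedralCones {-a}

/-- A simple valuation is additive when a cone is cut by a hyperplane. -/
lemma IsValuationOn.eq_add_of_cut (hval : IsValuationOn (polyhedralCones n) φ)
    (hsimple : IsSimple n φ) {C : Set (Euc n)} (hC : C ∈ polyhedralCones n) {a : Euc n}
    (ha : a ≠ 0) :
    φ C = φ (C ∩ {x | 0 ≤ inner ℝ x a}) + φ (C ∩ {x | inner ℝ x a ≤ 0}) := by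
  have hpos := inter_mem_polyhedralCones hC (setOf_inner_nonneg_mem a)
  have hneg := inter_mem_polyhedralCones hC (setOf_inner_nonpos_mem a)
  have hun : C ∩ {x | 0 ≤ inner ℝ x a} ∪ C ∩ {x | inner ℝ x a ≤ 0} = C := by
    rw [← Set.inter_union_distrib_left]
    exact Set.inter_eq_left.2 fun x _ => le_total 0 (inner ℝ x a)
  have h := hval.additive _ hpos _ hneg (hun.symm ▸ hC)
  rw [hun, hsimple.eq_zero_of_subset_hyperplane (inter_mem_polyhedralCones hpos hneg) ha
    (fun x hx => le_antisymm hx.2.2 hx.1.2), add_zero] at h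
  exact h

/-- The closed chamber of the arrangement of the hyperplanes with normals in `W` on which exactly
the normals in `T` are required to be nonpositive. -/
def chamber (W T : Finset (Euc n)) : Set (Euc n) :=
  {x | (∀ a ∈ T, inner ℝ x a ≤ 0) ∧ ∀ a ∈ W, a ∉ T → 0 ≤ inner ℝ x a}

lemma chamber_mem_polyhedralCones (W T : Finset (Euc n)) :
    chamber W T ∈ polyhedralCones n := by
  classical
  have h := inter_mem_polyhedralCones (setOf_inner_nonpos_mem_polyhedralCones T)
    (setOf_inner_nonpos_mem_polyhedralCones ((W \ T).image fun a => -a))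
  convert h using 1
  ext x
  simp only [chamber, Set.mem_inter_iff, Set.mem_ofPred_eq, Finset.forall_mem_image,
    Finset.mem_sdiff, inner_neg_right, neg_nonpos, and_imp]

lemma chamber_insert_of_notMem {W T : Finset (Euc n)} {a : Euc n} [DecidableEq (Euc n)]
    (haT : a ∉ T) : chamber (insert a W) T = chamber W T ∩ {x | 0 ≤ inner ℝ x a} := by
  ext x
  simp only [chamber, Set.mem_inter_iff, Set.mem_ofPred_eq, Finset.forall_mem_insert]
  tauto

lemma chamber_insert_insert {W T : Finset (Euc n)} {a : Euc n} [DecidableEq (Euc n)]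
    (ha : a ∉ W) : chamber (insert a W) (insert a T) = chamber W T ∩ {x | inner ℝ x a ≤ 0} := by
  ext x
  simp only [chamber, Set.mem_inter_iff, Set.mem_ofPred_eq, Finset.mem_insert,
    forall_eq_or_imp, true_or, not_true, false_imp_iff, true_and]
  have h : (∀ b ∈ W, ¬(b = a ∨ b ∈ T) → 0 ≤ inner ℝ x b) ↔
      ∀ b ∈ W, b ∉ T → 0 ≤ inner ℝ x b :=
    forall₂_congr fun b hb => by
      have hba : b ≠ a := ne_of_mem_of_not_mem hb ha
      simp only [hba, false_or]
  rw [h]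
  tauto

lemma IsValuationOn.eq_sum_chambers (hval : IsValuationOn (polyhedralCones n) φ)
    (hsimple : IsSimple n φ) (W : Finset (Euc n)) (hW : ∀ a ∈ W, a ≠ 0) {C : Set (Euc n)}
    (hC : C ∈ polyhedralCones n) :
    φ C = ∑ T ∈ W.powerset, φ (C ∩ chamber W T) := by
  classical
  induction W using Finset.induction_on with
  | empty => simp [chamber]
  | insert a W ha ih =>
    rw [Finset.sum_powerset_insert ha, ← Finset.sum_add_distrib,
      ih fun b hb => hW b (Finset.mem_insert_of_mem hb)]
    refine Finset.sum_congr rfl fun T hT => ?_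
    rw [Finset.mem_powerset] at hT
    have haT : a ∉ T := fun h => ha (hT h)
    rw [hval.eq_add_of_cut hsimple (inter_mem_polyhedralCones hC (chamber_mem_polyhedralCones W T))
      (hW a (Finset.mem_insert_self a W))]
    rw [chamber_insert_of_notMem haT, chamber_insert_insert ha, Set.inter_assoc, Set.inter_assoc]

/-- A chamber of nonzero valuation is full-dimensional, so that it contains a point off all the
hyperplanes: the sum of one point off each of them. -/
lemma IsSimple.exists_mem_chamber (hsimple : IsSimple n φ) {W T : Finset (Euc n)}
    (hW : ∀ a ∈ W, a ≠ 0) (h : φ (chamber W T) ≠ 0) :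
    ∃ u ∈ chamber W T, ∀ a ∈ W, inner ℝ u a ≠ 0 := by
  classical
  have hex : ∀ a, ∃ x, a ∈ W → x ∈ chamber W T ∧ inner ℝ x a ≠ 0 := by
    intro a
    by_cases ha : a ∈ W
    · by_contra! hcon
      exact h (hsimple.eq_zero_of_subset_hyperplane (chamber_mem_polyhedralCones W T) (hW a ha)
        fun x hx => ((hcon x).2 hx))
    · exact ⟨0, fun h => absurd h ha⟩
  choose x hx using hex
  refine ⟨∑ b ∈ W, x b, ⟨fun a ha => ?_, fun a ha haT => ?_⟩, fun a ha => ?_⟩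
  · rw [sum_inner]
    exact Finset.sum_nonpos fun b hb => (hx b hb).1.1 a ha
  · rw [sum_inner]
    exact Finset.sum_nonneg fun b hb => (hx b hb).1.2 a ha haT
  · rw [sum_inner]
    by_cases haT : a ∈ T
    · rw [Ne, Finset.sum_eq_zero_iff_of_nonpos fun b hb => (hx b hb).1.1 a haT]
      exact fun hcon => (hx a ha).2 (hcon a ha)
    · rw [Ne, Finset.sum_eq_zero_iff_of_nonneg fun b hb => (hx b hb).1.2 a ha haT]
      exact fun hcon => (hx a ha).2 (hcon a ha)

/-- Simple valuations on cones respect linear relations between indicators that hold off finitely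
many hyperplanes. In the arrangement of these hyperplanes and all facet hyperplanes, the valuation
of each of the cones is a weighted count of the chambers in it, and membership of a chamber in a
cone can be tested at an interior point of the chamber. -/
lemma IsValuationOn.sum_eq_zero_of_generic (hval : IsValuationOn (polyhedralCones n) φ)
    (hsimple : IsSimple n φ) {ι : Type*} (I : Finset ι) (a : ι → ℝ) (C : ι → Set (Euc n))
    (hC : ∀ i ∈ I, C i ∈ polyhedralCones n) (W : Finset (Euc n)) (hW : ∀ w ∈ W, w ≠ 0)
    (h : ∀ u : Euc n, (∀ w ∈ W, inner ℝ u w ≠ 0) →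
      ∑ i ∈ I, (C i).indicator (fun _ => a i) u = 0) :
    ∑ i ∈ I, a i * φ (C i) = 0 := by
  classical
  choose U hU0 hUC using fun i : I => exists_finset_of_mem_polyhedralCones (hC i i.2)
  set W' := W ∪ Finset.univ.biUnion U with hW'
  have hUW : ∀ i, U i ⊆ W' := fun i =>
    (Finset.subset_biUnion_of_mem U (Finset.mem_univ i)).trans Finset.subset_union_right
  have hW0 : ∀ w ∈ W', w ≠ 0 := by
    intro w hw
    rcases Finset.mem_union.1 hw with hw | hw
    · exact hW w hw
    · obtain ⟨i, -, hi⟩ := Finset.mem_biUnion.1 hw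
      exact hU0 i w hi
  have hsub : ∀ T, ∀ i : I, U i ⊆ T → C i ∩ chamber W' T = chamber W' T := fun T i hi => by
    refine Set.inter_eq_right.2 fun x hx => ?_
    rw [hUC i]
    exact fun u hu => hx.1 u (hi hu)
  have hnsub : ∀ T, ∀ i : I, ¬ U i ⊆ T → φ (C i ∩ chamber W' T) = 0 := fun T i hi => by
    obtain ⟨w, hw, hwT⟩ := Finset.not_subset.1 hi
    refine hsimple.eq_zero_of_subset_hyperplane
      (inter_mem_polyhedralCones (hC i i.2) (chamber_mem_polyhedralCones W' T)) (hU0 i w hw)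
      fun x hx => ?_
    have hx1 := hx.1
    rw [hUC i] at hx1
    exact le_antisymm (hx1 w hw) (hx.2.2 w (hUW i hw) hwT)
  have hdec : ∀ i ∈ I, a i * φ (C i) = ∑ T ∈ W'.powerset, a i * φ (C i ∩ chamber W' T) :=
    fun i hi => by rw [hval.eq_sum_chambers hsimple W' hW0 (hC i hi), Finset.mul_sum]
  rw [Finset.sum_congr rfl hdec, Finset.sum_comm]
  refine Finset.sum_eq_zero fun T hT => ?_
  rw [Finset.mem_powerset] at hT
  by_cases hφ : φ (chamber W' T) = 0
  · refine Finset.sum_eq_zero fun i hi => ?_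
    by_cases hUT : U ⟨i, hi⟩ ⊆ T
    · rw [hsub T ⟨i, hi⟩ hUT, hφ, mul_zero]
    · rw [hnsub T ⟨i, hi⟩ hUT, mul_zero]
  · obtain ⟨u, hu, hu0⟩ := hsimple.exists_mem_chamber hW0 hφ
    rw [← zero_mul (φ (chamber W' T)),
      ← h u fun w hw => hu0 w (Finset.mem_union_left _ hw), Finset.sum_mul]
    refine Finset.sum_congr rfl fun i hi => ?_
    by_cases hUT : U ⟨i, hi⟩ ⊆ T
    · have huC : u ∈ C i := ((hsub T ⟨i, hi⟩ hUT).symm.subset hu).1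
      rw [hsub T ⟨i, hi⟩ hUT, Set.indicator_of_mem huC]
    · have huC : u ∉ C i := by
        intro huC
        obtain ⟨w, hw, hwT⟩ := Finset.not_subset.1 hUT
        rw [hUC ⟨i, hi⟩] at huC
        have hw' := hUW ⟨i, hi⟩ hw
        exact hu0 w hw' (le_antisymm (huC w hw) (hu.2 w hw' hwT))
      rw [hnsub T ⟨i, hi⟩ hUT, Set.indicator_of_notMem huC, mul_zero, zero_mul]

end SimpleValuations

/-! ### Extension to finite unions of cones -/

section Extension

variable {n : ℕ} {φ : Set (Euc n) → ℝ}

/-- The dual of a simple valuation extends to a linear functional on all real functions, evaluated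
at indicators. -/
lemma IsValuationOn.exists_linearMap_dualValuation (hval : IsValuationOn (polyhedralCones n) φ)
    (hsimple : IsSimple n φ) :
    ∃ Λ : (Euc n → ℝ) →ₗ[ℝ] ℝ, ∀ C ∈ polyhedralCones n,
      Λ (C.indicator 1) = dualValuation φ C := by
  let L : (polyhedralCones n →₀ ℝ) →ₗ[ℝ] (Euc n → ℝ) :=
    Finsupp.linearCombination ℝ fun C => (C : Set (Euc n)).indicator 1
  let M : (polyhedralCones n →₀ ℝ) →ₗ[ℝ] ℝ :=
    Finsupp.linearCombination ℝ fun C => dualValuation φ (C : Set (Euc n))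
  have hker : LinearMap.ker L ≤ LinearMap.ker M := by
    intro f hf
    rw [LinearMap.mem_ker, Finsupp.linearCombination_apply, Finsupp.sum] at hf ⊢
    refine hval.sum_eq_zero_of_generic hsimple f.support f (fun C => dualCone (C : Set (Euc n)))
      (fun C _ => dualCone_mem_polyhedralCones C.2) ∅ (by simp) fun u _ => ?_
    refine sum_indicator_dualCone_eq_zero f.support f (fun C => (C : Set (Euc n)))
      (fun C _ => C.2) (fun x => ?_) u
    have hx := congrFun hf x
    rw [Finset.sum_apply] at hx
    refine Eq.trans (Finset.sum_congr rfl fun C _ => ?_) hx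
    rw [Pi.smul_apply, smul_eq_mul]
    by_cases hxC : x ∈ (C : Set (Euc n)) <;> simp [hxC]
  obtain ⟨Λ, hΛ⟩ := LinearMap.exists_extend
    ((LinearMap.ker L).liftQ M hker ∘ₗ L.quotKerEquivRange.symm.toLinearMap)
  refine ⟨Λ, fun C hC => ?_⟩
  have h1 : L (Finsupp.single ⟨C, hC⟩ 1) = C.indicator 1 := by simp [L]
  have h2 := LinearMap.congr_fun hΛ ⟨L (Finsupp.single ⟨C, hC⟩ 1), LinearMap.mem_range_self _ _⟩
  rw [← h1]
  refine h2.trans ?_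
  rw [LinearMap.comp_apply, LinearEquiv.coe_coe, LinearMap.quotKerEquivRange_symm_apply_image,
    Submodule.mkQ_apply, Submodule.liftQ_apply]
  simp [M]

lemma isAdditiveExtension_of_linearMap {X : Type*} {S : Set (Set X)} {φ : Set X → ℝ}
    (Λ : (X → ℝ) →ₗ[ℝ] ℝ) (hΛ : ∀ C ∈ S, Λ (C.indicator 1) = φ C) :
    IsAdditiveExtension S φ fun A => Λ (A.indicator 1) where
  valuation :=
    { additive := fun A _ B _ _ => by
        rw [← map_add, ← map_add, Set.indicator_union_add_inter]
      empty := fun _ => by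
        simp only [Set.indicator_empty]
        exact map_zero Λ }
  extends_on := hΛ

/-- On an intersectional family, an additive extension to finite unions is unique, so that it is
given by any linear functional that gives the values on the family. -/
lemma IsAdditiveExtension.eq_linearMap {X : Type*} {S : Set (Set X)} {φ ψ : Set X → ℝ}
    (hS : ∀ A ∈ S, ∀ B ∈ S, A ∩ B ∈ S) (hψ : IsAdditiveExtension S φ ψ)
    (Λ : (X → ℝ) →ₗ[ℝ] ℝ) (hΛ : ∀ C ∈ S, Λ (C.indicator 1) = φ C) {A : Set X}
    (hA : A ∈ finiteUnions S) : ψ A = Λ (A.indicator 1) := by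
  classical
  have hΛ' := isAdditiveExtension_of_linearMap Λ hΛ
  have hbase : ∀ C ∈ S, C ∈ finiteUnions S := fun C hC =>
    ⟨{C}, Set.finite_singleton C, by simpa using hC, by simp⟩
  -- The number of members is the induction variable, as the family changes on intersection.
  have key : ∀ (k : ℕ) (F : Finset (Set X)), F.card ≤ k → (F : Set (Set X)) ⊆ S →
      ψ (⋃₀ (F : Set (Set X))) = Λ ((⋃₀ (F : Set (Set X))).indicator 1) := by
    intro k
    induction k with
    | zero =>
      intro F hF _
      obtain rfl : F = ∅ := by simpa using hF
      rw [Finset.coe_empty, Set.sUnion_empty, Set.indicator_empty]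
      refine Eq.trans ?_ (map_zero Λ).symm
      exact hψ.valuation.empty ⟨∅, Set.finite_empty, by simp, by simp⟩
    | succ k ih =>
      intro F hF hFS
      rcases F.eq_empty_or_nonempty with rfl | ⟨C, hCF⟩
      · exact ih ∅ (by simp) hFS
      · set G := F.erase C with hG
        have hGcard : G.card ≤ k := by
          rw [hG, Finset.card_erase_of_mem hCF]
          omega
        have hGS : (G : Set (Set X)) ⊆ S := fun B hB => hFS (Finset.mem_of_mem_erase hB)
        have hCS : C ∈ S := hFS hCF
        have hFG : ⋃₀ (F : Set (Set X)) = C ∪ ⋃₀ (G : Set (Set X)) := by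
          rw [← Finset.insert_erase hCF, Finset.coe_insert, Set.sUnion_insert]
        have hinter : C ∩ ⋃₀ (G : Set (Set X)) =
            ⋃₀ ((G.image fun B => C ∩ B : Finset (Set X)) : Set (Set X)) := by
          rw [Finset.coe_image, Set.sUnion_image, Set.sUnion_eq_biUnion, Set.inter_iUnion₂]
        have himS : ((G.image fun B => C ∩ B : Finset (Set X)) : Set (Set X)) ⊆ S := by
          intro B hB
          obtain ⟨B', hB', rfl⟩ := Finset.mem_image.1 hB
          exact hS C hCS B' (hGS hB')
        have h1 := ih _ hGcard hGS
        have h2 := ih _ (Finset.card_image_le.trans hGcard) himS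
        rw [← hinter] at h2
        have hGU : ⋃₀ (G : Set (Set X)) ∈ finiteUnions S := ⟨G, G.finite_toSet, hGS, rfl⟩
        have hFU : C ∪ ⋃₀ (G : Set (Set X)) ∈ finiteUnions S :=
          hFG ▸ ⟨F, F.finite_toSet, hFS, rfl⟩
        have h3 := hψ.valuation.additive C (hbase C hCS) _ hGU hFU
        have h4 := hΛ'.valuation.additive C (hbase C hCS) _ hGU hFU
        have h5 := hψ.extends_on C hCS
        have h6 := hΛ C hCS
        rw [hFG]
        linarith
  obtain ⟨F, hF, hFS, rfl⟩ := hA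
  have := key hF.toFinset.card hF.toFinset le_rfl (by simpa using hFS)
  simpa using this

end Extension

/-! ### Triangulations of polyhedra -/

section Cells

variable {E ι : Type*} [NormedAddCommGroup E] [NormedSpace ℝ E] (f : ι → E →ᵃ[ℝ] ℝ)

/-- For an arrangement of hyperplanes `f i = 0`, the point `y` lies in the closure of the (relatively
open) cell of `x`; cells are the sets on which all signs of the `f i` are constant. -/
def CellLE (y x : E) : Prop :=
  ∀ i, f i y = 0 ∨ SignType.sign (f i y) = SignType.sign (f i x)

/-- The sign vector of `x`, which determines the cell of `x`. -/
noncomputable def cellSign (x : E) : ι → SignType := fun i => SignType.sign (f i x)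

variable {f}

lemma cellLE_of_cellSign_eq {x y : E} (h : cellSign f y = cellSign f x) : CellLE f y x :=
  fun i => Or.inr (congrFun h i)

lemma CellLE.refl (x : E) : CellLE f x x := fun _ => Or.inr rfl

lemma CellLE.eq_zero {x y : E} (h : CellLE f y x) {i : ι} (hx : f i x = 0) : f i y = 0 := by
  rcases h i with h | h
  · exact h
  · rwa [hx, sign_zero, sign_eq_zero_iff] at h

lemma CellLE.trans {x y z : E} (hzy : CellLE f z y) (hyx : CellLE f y x) : CellLE f z x := by
  intro i
  rcases hzy i with h | h
  · exact Or.inl h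
  · rcases hyx i with h' | h'
    · exact Or.inl (hzy.eq_zero h')
    · exact Or.inr (h.trans h')

lemma CellLE.exists_eq_zero {x y : E} (h : CellLE f y x) (hne : cellSign f y ≠ cellSign f x) :
    ∃ i, f i y = 0 ∧ f i x ≠ 0 := by
  by_contra! hcon
  refine hne (funext fun i => ?_)
  rcases h i with hi | hi
  · simp only [cellSign, hi, hcon i hi]
  · exact hi

lemma CellLE.mul_nonneg {x y : E} (h : CellLE f y x) (i : ι) : 0 ≤ f i y * f i x := by
  rcases h i with h | h
  · rw [h, zero_mul]
  · rw [← sign_nonneg_iff, sign_mul, h]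
    cases SignType.sign (f i x) <;> decide

lemma cellLE_iff {x y : E} :
    CellLE f y x ↔ ∀ i, 0 ≤ f i y * f i x ∧ (f i x = 0 → f i y = 0) := by
  refine ⟨fun h i => ⟨h.mul_nonneg i, h.eq_zero⟩, fun h i => ?_⟩
  obtain ⟨h1, h2⟩ := h i
  rcases eq_or_ne (f i y) 0 with hy | hy
  · exact Or.inl hy
  · refine Or.inr ?_
    have hx : f i x ≠ 0 := fun hx => hy (h2 hx)
    rcases lt_or_gt_of_ne hx with hx | hx <;> rcases lt_or_gt_of_ne hy with hy | hy
    · rw [sign_neg hx, sign_neg hy]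
    · nlinarith
    · nlinarith
    · rw [sign_pos hx, sign_pos hy]

lemma convex_setOf_cellLE (x : E) : Convex ℝ {y | CellLE f y x} := by
  intro y hy z hz a b ha hb hab
  rw [Set.mem_ofPred_eq, cellLE_iff] at hy hz ⊢
  intro i
  have h : f i (a • y + b • z) = a * f i y + b * f i z := by
    rw [Convex.combo_affine_apply hab, smul_eq_mul, smul_eq_mul]
  rw [h]
  refine ⟨?_, fun hx => by rw [(hy i).2 hx, (hz i).2 hx, mul_zero, mul_zero, add_zero]⟩
  rw [add_mul, mul_assoc, mul_assoc]
  exact add_nonneg (_root_.mul_nonneg ha (hy i).1) (_root_.mul_nonneg hb (hz i).1)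

variable (f) in
/-- The points of `s` lie in a chain of cells. -/
def IsCellChain (s : Finset E) : Prop :=
  ∀ v ∈ s, ∀ w ∈ s, CellLE f v w ∨ CellLE f w v

lemma IsCellChain.mono {s t : Finset E} (hs : IsCellChain f s) (hts : t ⊆ s) : IsCellChain f t :=
  fun v hv w hw => hs v (hts hv) w (hts hw)

lemma IsCellChain.exists_top {s : Finset E} (hs : IsCellChain f s) (hne : s.Nonempty) :
    ∃ p ∈ s, ∀ v ∈ s, CellLE f v p := by
  classical
  induction hne using Finset.Nonempty.cons_induction with
  | singleton a => exact ⟨a, by simp, by simpa using CellLE.refl a⟩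
  | cons a s ha hne ih =>
    obtain ⟨p, hp, hsp⟩ := ih (hs.mono (Finset.subset_cons ha))
    rcases hs a (by simp) p (by simp [hp]) with h | h
    · refine ⟨p, by simp [hp], fun v hv => ?_⟩
      rcases Finset.mem_cons.1 hv with rfl | hv
      exacts [h, hsp v hv]
    · refine ⟨a, by simp, fun v hv => ?_⟩
      rcases Finset.mem_cons.1 hv with rfl | hv
      exacts [CellLE.refl v, (hsp v hv).trans h]

/-- A weighted sum of values of an affine function depends only on the total weight and the
weighted sum of the points. -/
lemma affineMap_sum_eq {w w' : E →₀ ℝ} (g : E →ᵃ[ℝ] ℝ)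
    (hmass : ∑ v ∈ w.support, w v = ∑ v ∈ w'.support, w' v)
    (hbary : ∑ v ∈ w.support, w v • v = ∑ v ∈ w'.support, w' v • v) :
    ∑ v ∈ w.support, w v * g v = ∑ v ∈ w'.support, w' v * g v := by
  have h : ∀ u : E →₀ ℝ, ∑ v ∈ u.support, u v * g v
      = g.linear (∑ v ∈ u.support, u v • v) + g 0 * ∑ v ∈ u.support, u v := by
    intro u
    rw [map_sum, Finset.mul_sum, ← Finset.sum_add_distrib]
    refine Finset.sum_congr rfl fun v _ => ?_
    have hv : g v = g.linear v + g 0 := by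
      simpa using congrFun g.decomp v
    rw [hv, map_smul, smul_eq_mul]
    ring
  rw [h w, h w', hmass, hbary]

lemma sign_sum_of_top {w : E →₀ ℝ} (hw : ∀ v, 0 ≤ w v) {p : E} (hp : p ∈ w.support)
    (htop : ∀ v ∈ w.support, CellLE f v p) (i : ι) :
    SignType.sign (∑ v ∈ w.support, w v * f i v) = SignType.sign (f i p) := by
  have hwp : 0 < w p := lt_of_le_of_ne (hw p) (Finsupp.mem_support_iff.1 hp).symm
  have hle : w p * (f i p * f i p) ≤ (∑ v ∈ w.support, w v * f i v) * f i p := by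
    rw [Finset.sum_mul]
    refine le_trans (le_of_eq (by ring)) (Finset.single_le_sum
      (f := fun v => w v * f i v * f i p) (fun v hv => ?_) hp)
    rw [mul_assoc]
    exact _root_.mul_nonneg (hw v) ((htop v hv).mul_nonneg i)
  rcases lt_trichotomy (f i p) 0 with h | h | h
  · rw [sign_neg h, sign_neg]
    have : 0 < w p * (f i p * f i p) := mul_pos hwp (mul_pos_of_neg_of_neg h h)
    nlinarith
  · rw [h, sign_zero, sign_eq_zero_iff]
    exact Finset.sum_eq_zero fun v hv => by rw [(htop v hv).eq_zero h, mul_zero]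
  · rw [sign_pos h, sign_pos]
    have : 0 < w p * (f i p * f i p) := mul_pos hwp (mul_pos h h)
    nlinarith

/-- Comparison of the top weights of two chains with the same top and the same barycenter: on a
hyperplane that contains the rest of the first chain, only the top contributes to the first
barycenter. -/
lemma weight_top_le {w w' : E →₀ ℝ} (hw' : ∀ v, 0 ≤ w' v)
    (hchain : IsCellChain f w.support)
    (hinj : ∀ v ∈ w.support, ∀ u ∈ w.support, cellSign f v = cellSign f u → v = u)
    (hmass : ∑ v ∈ w.support, w v = ∑ v ∈ w'.support, w' v)
    (hbary : ∑ v ∈ w.support, w v • v = ∑ v ∈ w'.support, w' v • v)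
    {p : E} (hp : p ∈ w.support) (hp' : p ∈ w'.support) (htop : ∀ v ∈ w.support, CellLE f v p)
    (htop' : ∀ v ∈ w'.support, CellLE f v p) : w' p ≤ w p := by
  classical
  rcases (w.support.erase p).eq_empty_or_nonempty with he | hne
  · have h1 : ∑ v ∈ w.support, w v = w p := by
      rw [← Finset.insert_erase hp, he]
      simp
    rw [← h1, hmass]
    exact Finset.single_le_sum (f := fun v => w' v) (fun v _ => hw' v) hp'
  · obtain ⟨r, hr, hrtop⟩ := (hchain.mono (Finset.erase_subset p _)).exists_top hne
    have hr' := Finset.mem_erase.1 hr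
    obtain ⟨i, hir, hip⟩ := (htop r hr'.2).exists_eq_zero
      fun h => hr'.1 (hinj r hr'.2 p hp h)
    have h1 : ∑ v ∈ w.support, w v * f i v = w p * f i p := by
      refine Finset.sum_eq_single_of_mem p hp fun v hv hvp => ?_
      rw [(hrtop v (Finset.mem_erase.2 ⟨hvp, hv⟩)).eq_zero hir, mul_zero]
    have h2 : w' p * (f i p * f i p) ≤ (∑ v ∈ w'.support, w' v * f i v) * f i p := by
      rw [Finset.sum_mul]
      refine le_trans (le_of_eq (by ring)) (Finset.single_le_sum
        (f := fun v => w' v * f i v * f i p) (fun v hv => ?_) hp')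
      rw [mul_assoc]
      exact _root_.mul_nonneg (hw' v) ((htop' v hv).mul_nonneg i)
    rw [← affineMap_sum_eq (f i) hmass hbary, h1, mul_assoc] at h2
    exact le_of_mul_le_mul_right h2 (mul_self_pos.2 hip)

/-- Barycentric coordinates with respect to chains of cells are unique. The cell of a barycenter
is the cell of the top of the chain, which determines the top; its weight is determined by
`weight_top_le`, and removing the top gives shorter chains. -/
lemma weights_eq_of_isCellChain {V : Set E}
    (hV : ∀ v ∈ V, ∀ u ∈ V, cellSign f v = cellSign f u → v = u) :
    ∀ (k : ℕ) (w w' : E →₀ ℝ), w.support.card ≤ k → (∀ v, 0 ≤ w v) → (∀ v, 0 ≤ w' v) →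
    (w.support : Set E) ⊆ V → (w'.support : Set E) ⊆ V →
    IsCellChain f w.support → IsCellChain f w'.support →
    ∑ v ∈ w.support, w v = ∑ v ∈ w'.support, w' v →
    ∑ v ∈ w.support, w v • v = ∑ v ∈ w'.support, w' v • v → w = w' := by
  classical
  have hzero : ∀ u : E →₀ ℝ, (∀ v, 0 ≤ u v) → ∑ v ∈ u.support, u v = 0 → u = 0 := by
    intro u hu h
    rw [Finset.sum_eq_zero_iff_of_nonneg fun v _ => hu v] at h
    rw [← Finsupp.support_eq_empty, Finset.eq_empty_iff_forall_notMem]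
    exact fun v hv => Finsupp.mem_support_iff.1 hv (h v hv)
  intro k
  induction k with
  | zero =>
    intro w w' hk hw hw' _ _ _ _ hmass _
    obtain rfl : w = 0 := by simpa using hk
    exact (hzero w' hw' (by simpa using hmass.symm)).symm
  | succ k ih =>
    intro w w' hk hw hw' hwV hw'V hc hc' hmass hbary
    rcases eq_or_ne w 0 with rfl | hw0
    · exact (hzero w' hw' (by simpa using hmass.symm)).symm
    rcases eq_or_ne w' 0 with rfl | hw0'
    · exact hzero w hw (by simpa using hmass)
    obtain ⟨p, hp, htop⟩ := hc.exists_top (Finsupp.support_nonempty_iff.2 hw0)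
    obtain ⟨q, hq, htop'⟩ := hc'.exists_top (Finsupp.support_nonempty_iff.2 hw0')
    obtain rfl : p = q := hV p (hwV hp) q (hw'V hq) (funext fun i => by
      rw [cellSign, ← sign_sum_of_top hw hp htop i, affineMap_sum_eq (f i) hmass hbary,
        sign_sum_of_top hw' hq htop' i, cellSign])
    have hpp : w p = w' p := le_antisymm
      (weight_top_le hw hc' (fun v hv u hu => hV v (hw'V hv) u (hw'V hu)) hmass.symm
        hbary.symm hq hp htop' htop)
      (weight_top_le hw' hc (fun v hv u hu => hV v (hwV hv) u (hwV hu)) hmass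
        hbary hp hq htop htop')
    have herase : w.erase p = w'.erase p := by
      refine ih _ _ ?_ ?_ ?_ ?_ ?_ ?_ ?_ ?_ ?_
      · rw [Finsupp.support_erase, Finset.card_erase_of_mem hp]
        omega
      · intro v
        rw [Finsupp.erase_apply]
        split_ifs
        exacts [le_rfl, hw v]
      · intro v
        rw [Finsupp.erase_apply]
        split_ifs
        exacts [le_rfl, hw' v]
      · rw [Finsupp.support_erase]
        exact fun v hv => hwV (Finset.mem_of_mem_erase hv)
      · rw [Finsupp.support_erase]
        exact fun v hv => hw'V (Finset.mem_of_mem_erase hv)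
      · rw [Finsupp.support_erase]
        exact hc.mono (Finset.erase_subset _ _)
      · rw [Finsupp.support_erase]
        exact hc'.mono (Finset.erase_subset _ _)
      · have h1 : ∀ u : E →₀ ℝ, p ∈ u.support → ∑ v ∈ (u.erase p).support, u.erase p v
            = ∑ v ∈ u.support, u v - u p := by
          intro u hu
          rw [Finsupp.support_erase, ← Finset.add_sum_erase _ _ hu, add_sub_cancel_left]
          exact Finset.sum_congr rfl fun v hv => Finsupp.erase_ne (Finset.ne_of_mem_erase hv)
        rw [h1 w hp, h1 w' hq, hmass, hpp]
      · have h1 : ∀ u : E →₀ ℝ, p ∈ u.support →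
            ∑ v ∈ (u.erase p).support, u.erase p v • v
              = ∑ v ∈ u.support, u v • v - u p • p := by
          intro u hu
          rw [Finsupp.support_erase, ← Finset.add_sum_erase _ _ hu, add_sub_cancel_left]
          exact Finset.sum_congr rfl fun v hv => by
            rw [Finsupp.erase_ne (Finset.ne_of_mem_erase hv)]
        rw [h1 w hp, h1 w' hq, hbary, hpp]
    ext v
    rcases eq_or_ne v p with rfl | hv
    · exact hpp
    · rw [← Finsupp.erase_ne (f := w) hv, herase, Finsupp.erase_ne hv]

/-- The ray from a point `p` of the cell of `x` through `x` leaves the cell, if the closure of the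
cell is bounded. -/
lemma exists_lineMap_mem_boundary [Finite ι] {p x : E}
    (hb : Bornology.IsBounded {y | CellLE f y x}) (hpx : cellSign f p = cellSign f x)
    (hne : p ≠ x) :
    ∃ t : ℝ, 1 ≤ t ∧ CellLE f (AffineMap.lineMap p x t) x ∧
      ∃ i, f i (AffineMap.lineMap p x t) = 0 ∧ f i x ≠ 0 := by
  set g : ℝ → E := fun t => AffineMap.lineMap p x t with hg
  have hfg : ∀ i t, f i (g t) = (1 - t) * f i p + t * f i x := by
    intro i t
    rw [hg]
    dsimp only
    rw [AffineMap.apply_lineMap, AffineMap.lineMap_apply_ring]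
  have hcont : ∀ i, Continuous fun t => f i (g t) := by
    intro i
    simp only [hfg]
    fun_prop
  have hcell : ∀ t, CellLE f (g t) x ↔ ∀ i, 0 ≤ f i (g t) * f i x := by
    intro t
    rw [cellLE_iff]
    refine forall_congr' fun i => and_iff_left fun hx => ?_
    rw [hfg, (cellLE_of_cellSign_eq hpx).eq_zero hx, hx, mul_zero, mul_zero, add_zero]
  set T : Set ℝ := {t | 1 ≤ t ∧ CellLE f (g t) x} with hT
  have hT1 : (1 : ℝ) ∈ T := ⟨le_rfl, by
    rw [hg]
    dsimp only
    rw [AffineMap.lineMap_apply_one]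
    exact CellLE.refl x⟩
  have hTclosed : IsClosed T := by
    simp only [hT, hcell, Set.ofPred_and, Set.ofPred_forall]
    exact (isClosed_le continuous_const continuous_id).inter
      (isClosed_iInter fun i => isClosed_le continuous_const ((hcont i).mul continuous_const))
  have hTb : BddAbove T := by
    obtain ⟨R, hR⟩ := hb.exists_norm_le
    have hpos : 0 < ‖x - p‖ := norm_pos_iff.2 (sub_ne_zero.2 hne.symm)
    refine ⟨(R + ‖p‖) / ‖x - p‖, fun t ht => ?_⟩
    rw [le_div_iff₀ hpos]
    have h1 := hR _ ht.2
    have h2 : t • (x - p) = g t - p := by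
      rw [hg]
      dsimp only
      rw [AffineMap.lineMap_apply, vsub_eq_sub, vadd_eq_add, add_sub_cancel_right]
    calc t * ‖x - p‖ = ‖t • (x - p)‖ := by
          rw [norm_smul, Real.norm_of_nonneg (by linarith [ht.1])]
      _ ≤ ‖g t‖ + ‖p‖ := by rw [h2]; exact norm_sub_le _ _
      _ ≤ R + ‖p‖ := by linarith
  obtain ⟨hs1, hs2⟩ := hTclosed.csSup_mem ⟨1, hT1⟩ hTb
  refine ⟨sSup T, hs1, hs2, ?_⟩
  by_contra! hcon
  have hev : ∀ᶠ t in nhdsWithin (sSup T) (Set.Ioi (sSup T)), sSup T < t ∧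
      ∀ i, 0 ≤ f i (g t) * f i x := by
    refine Filter.Eventually.and self_mem_nhdsWithin (Filter.eventually_all.2 fun i => ?_)
    by_cases hx : f i x = 0
    · simp [hx]
    · have hpos : 0 < f i (g (sSup T)) * f i x :=
        lt_of_le_of_ne ((hcell _).1 hs2 i)
          (mul_ne_zero (fun h => hx (hcon i h)) hx).symm
      filter_upwards [nhdsWithin_le_nhds
        (((hcont i).mul continuous_const).continuousAt.eventually_const_lt hpos)] with t ht
      exact ht.le
  obtain ⟨t, ht, ht'⟩ := hev.exists
  exact absurd (le_csSup hTb ⟨by linarith, (hcell t).2 ht'⟩) (not_le.2 ht)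

/-- Every point of a bounded union of cells with a chosen center in each cell is in the convex
hull of a chain of centers: the ray from the center of its cell through the point hits the
boundary of the cell, where there is such a chain by induction. -/
lemma exists_chain_mem_convexHull [Finite ι] {P : Set E} (hb : Bornology.IsBounded P)
    (hP : ∀ x ∈ P, ∀ y, CellLE f y x → y ∈ P) {c : E → E}
    (hc : ∀ x ∈ P, c x ∈ P ∧ cellSign f (c x) = cellSign f x)
    (hcc : ∀ x y, cellSign f x = cellSign f y → c x = c y) :
    ∀ (k : ℕ) (x : E), x ∈ P → {i | f i x ≠ 0}.ncard ≤ k →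
      ∃ s : Finset E, s.Nonempty ∧ (∀ v ∈ s, v ∈ P ∧ c v = v) ∧ IsCellChain f s ∧
        x ∈ convexHull ℝ (s : Set E) ∧ ∀ v ∈ s, CellLE f v x := by
  classical
  intro k
  induction k using Nat.strong_induction_on with
  | _ k ih =>
    intro x hx hk
    obtain ⟨hpP, hpx⟩ := hc x hx
    have hcp : c (c x) = c x := hcc _ _ hpx
    rcases eq_or_ne (c x) x with hpe | hpe
    · refine ⟨{x}, by simp, by simp [hx, hpe], ?_, by simp, by simpa using CellLE.refl x⟩
      intro v hv w hw
      rw [Finset.mem_singleton] at hv hw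
      rw [hv, hw]
      exact Or.inl (CellLE.refl x)
    · obtain ⟨t, ht, hyx, i, hiy, hix⟩ :=
        exists_lineMap_mem_boundary (hb.subset fun y hy => hP x hx y hy) hpx hpe
      set y : E := AffineMap.lineMap (c x) x t with hy
      have hlt : {i | f i y ≠ 0}.ncard < {i | f i x ≠ 0}.ncard := by
        refine Set.ncard_lt_ncard (Set.ssubset_iff_subset_ne.2 ⟨fun j hj hjx => ?_, fun h => ?_⟩)
          (Set.toFinite _)
        · exact hj (hyx.eq_zero hjx)
        · have : i ∈ {i | f i y ≠ 0} := h ▸ hix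
          exact this hiy
      obtain ⟨s, hsne, hsV, hschain, hsy, hsle⟩ :=
        ih _ (lt_of_lt_of_le hlt hk) y (hP x hx y hyx) le_rfl
      have hsp : ∀ v ∈ s, CellLE f v (c x) := fun v hv =>
        ((hsle v hv).trans hyx).trans (cellLE_of_cellSign_eq hpx.symm)
      refine ⟨insert (c x) s, by simp, ?_, ?_, ?_, ?_⟩
      · intro v hv
        rcases Finset.mem_insert.1 hv with rfl | hv
        exacts [⟨hpP, hcp⟩, hsV v hv]
      · intro v hv w hw
        rcases Finset.mem_insert.1 hv with rfl | hv <;> rcases Finset.mem_insert.1 hw with rfl | hw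
        exacts [Or.inl (CellLE.refl _), Or.inr (hsp w hw), Or.inl (hsp v hv), hschain v hv w hw]
      · have h1 : c x ∈ convexHull ℝ ((insert (c x) s : Finset E) : Set E) :=
          subset_convexHull ℝ _ (by simp)
        have h2 : y ∈ convexHull ℝ ((insert (c x) s : Finset E) : Set E) :=
          convexHull_mono (by simp) hsy
        have h3 : x = AffineMap.lineMap (c x) y t⁻¹ := by
          have ht0 : t ≠ 0 := by positivity
          rw [hy, AffineMap.lineMap_apply, AffineMap.lineMap_apply]
          simp only [vsub_eq_sub, vadd_eq_add, add_sub_cancel_right, smul_smul]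
          rw [inv_mul_cancel₀ ht0, one_smul, sub_add_cancel]
        have h4 := (convex_convexHull ℝ _).lineMap_mem h1 h2
          (t := t⁻¹) ⟨by positivity, inv_le_one_of_one_le₀ ht⟩
        rwa [← h3] at h4
      · intro v hv
        rcases Finset.mem_insert.1 hv with rfl | hv
        exacts [cellLE_of_cellSign_eq hpx, (hsle v hv).trans hyx]

/-- A bounded union of cells, closed under passing to closures of cells, is triangulated by the
chains of cells, after a center has been chosen in each cell. -/
lemma exists_simplicialComplex_of_cells [Finite ι] (f : ι → E →ᵃ[ℝ] ℝ) {P : Set E}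
    (hb : Bornology.IsBounded P) (hP : ∀ x ∈ P, ∀ y, CellLE f y x → y ∈ P) :
    ∃ K : Geometry.SimplicialComplex ℝ E, K.faces.Finite ∧ K.space = P := by
  classical
  have hex : ∀ σ : ι → SignType, ∃ p, (∃ x ∈ P, cellSign f x = σ) → p ∈ P ∧ cellSign f p = σ := by
    intro σ
    by_cases h : ∃ x ∈ P, cellSign f x = σ
    · obtain ⟨x, hx⟩ := h
      exact ⟨x, fun _ => hx⟩
    · exact ⟨0, fun h' => absurd h' h⟩
  choose p hp using hex
  set c : E → E := fun x => p (cellSign f x) with hcdef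
  have hc : ∀ x ∈ P, c x ∈ P ∧ cellSign f (c x) = cellSign f x := fun x hx =>
    hp _ ⟨x, hx, rfl⟩
  have hcc : ∀ x y, cellSign f x = cellSign f y → c x = c y := fun x y h => congrArg p h
  set V : Set E := {v | v ∈ P ∧ c v = v} with hVdef
  have hV : ∀ v ∈ V, ∀ u ∈ V, cellSign f v = cellSign f u → v = u := fun v hv u hu h =>
    hv.2.symm.trans ((hcc v u h).trans hu.2)
  have hVfin : V.Finite :=
    Set.Finite.of_injOn (f := cellSign f) (t := Set.univ) (fun _ _ => Set.mem_univ _)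
      (fun v hv u hu h => hV v hv u hu h) Set.finite_univ
  have huniq : ∀ s t : Finset E, (s : Set E) ⊆ V → (t : Set E) ⊆ V → IsCellChain f s →
      IsCellChain f t → ∀ w w' : E → ℝ, (∀ v ∈ s, 0 ≤ w v) → (∀ v ∈ t, 0 ≤ w' v) →
      ∑ v ∈ s, w v = ∑ v ∈ t, w' v → ∑ v ∈ s, w v • v = ∑ v ∈ t, w' v • v →
      ∀ v, (if v ∈ s then w v else 0) = if v ∈ t then w' v else 0 := by
    intro s t hs ht hcs hct w w' hw hw' hmass hbary v
    set u : E →₀ ℝ := Finsupp.indicator s fun v _ => w v with hu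
    set u' : E →₀ ℝ := Finsupp.indicator t fun v _ => w' v with hu'
    have hsupp : ∀ (s : Finset E) (w : E → ℝ),
        (Finsupp.indicator s fun v _ => w v).support ⊆ s := fun s w =>
      Finsupp.support_indicator_subset _ _
    have hsum : ∀ (s : Finset E) (w : E → ℝ),
        ∑ v ∈ (Finsupp.indicator s fun v _ => w v).support, (Finsupp.indicator s fun v _ => w v) v
          = ∑ v ∈ s, w v := by
      intro s w
      rw [Finset.sum_subset (hsupp s w) fun v _ hv => Finsupp.notMem_support_iff.1 hv]
      exact Finset.sum_congr rfl fun v hv => Finsupp.indicator_of_mem hv _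
    have hsum' : ∀ (s : Finset E) (w : E → ℝ),
        ∑ v ∈ (Finsupp.indicator s fun v _ => w v).support,
          (Finsupp.indicator s fun v _ => w v) v • v = ∑ v ∈ s, w v • v := by
      intro s w
      rw [Finset.sum_subset (hsupp s w) fun v _ hv => by
        rw [Finsupp.notMem_support_iff.1 hv, zero_smul]]
      exact Finset.sum_congr rfl fun v hv => by rw [Finsupp.indicator_of_mem hv]
    have hnn : ∀ (s : Finset E) (w : E → ℝ), (∀ v ∈ s, 0 ≤ w v) →
        ∀ v, 0 ≤ (Finsupp.indicator s fun v _ => w v) v := by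
      intro s w h v
      rw [Finsupp.indicator_apply]
      split_ifs with hv
      exacts [h v hv, le_rfl]
    have huu : u = u' := weights_eq_of_isCellChain hV _ u u' le_rfl (hnn s w hw) (hnn t w' hw')
      (subset_trans (Finset.coe_subset.2 (hsupp s w)) hs)
      (subset_trans (Finset.coe_subset.2 (hsupp t w')) ht)
      (hcs.mono (hsupp s w)) (hct.mono (hsupp t w'))
      (by rw [hu, hu', hsum, hsum, hmass]) (by rw [hu, hu', hsum', hsum', hbary])
    have h := DFunLike.congr_fun huu v
    simpa [hu, hu', Finsupp.indicator_apply] using h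
  let K : Geometry.SimplicialComplex ℝ E :=
    { faces := {s | s.Nonempty ∧ (s : Set E) ⊆ V ∧ IsCellChain f s}
      isRelLowerSet_faces := fun s hs => ⟨hs.1, fun t hts ht =>
        ⟨ht, subset_trans (Finset.coe_subset.2 hts) hs.2.1, hs.2.2.mono hts⟩⟩
      indep := by
        intro s hs
        rw [affineIndependent_iff]
        intro A w hw0 hwb i hi
        -- A vanishing combination is split into its positive and its negative part.
        set B : Finset E := A.map (Function.Embedding.subtype _) with hB
        have hBs : B ⊆ s := by
          intro v hv
          obtain ⟨⟨v, hvs⟩, -, rfl⟩ := Finset.mem_map.1 hv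
          exact hvs
        set w' : E → ℝ := fun v => if h : v ∈ s then w ⟨v, h⟩ else 0 with hw'
        have hww : ∀ v : s, w' v = w v := fun v => by simp [hw']
        have h0 : ∑ v ∈ B, w' v = 0 := by
          rw [hB, Finset.sum_map]
          simpa [hww] using hw0
        have h1 : ∑ v ∈ B, w' v • v = 0 := by
          rw [hB, Finset.sum_map]
          simpa [hww] using hwb
        have hsplit : ∀ a : ℝ, max a 0 = max (-a) 0 + a := fun a => by
          rcases le_total 0 a with h | h
          · rw [max_eq_left h, max_eq_right (by linarith), zero_add]
          · rw [max_eq_right h, max_eq_left (by linarith), neg_add_cancel]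
        have h2 := huniq B B (subset_trans (Finset.coe_subset.2 hBs) hs.2.1)
          (subset_trans (Finset.coe_subset.2 hBs) hs.2.1) (hs.2.2.mono hBs) (hs.2.2.mono hBs)
          (fun v => max (w' v) 0) (fun v => max (-w' v) 0)
          (fun v _ => le_max_right _ _) (fun v _ => le_max_right _ _)
          (by
            simp only [hsplit (w' _)]
            rw [Finset.sum_add_distrib, h0, add_zero])
          (by
            simp only [hsplit (w' _), add_smul]
            rw [Finset.sum_add_distrib, h1, add_zero])
          i
        have hiB : (i : E) ∈ B := Finset.mem_map.2 ⟨i, hi, rfl⟩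
        rw [if_pos hiB, if_pos hiB, hsplit, add_eq_left, hww] at h2
        exact h2
      inter_subset_convexHull := by
        rintro s t hs ht x ⟨hxs, hxt⟩
        obtain ⟨w, hw, hw1, hwx⟩ := Finset.mem_convexHull'.1 hxs
        obtain ⟨w', hw', hw1', hwx'⟩ := Finset.mem_convexHull'.1 hxt
        have h := huniq s t hs.2.1 ht.2.1 hs.2.2 ht.2.2 w w' hw hw' (hw1.trans hw1'.symm)
          (hwx.trans hwx'.symm)
        have hoff : ∀ v ∈ s, v ∉ s ∩ t → w v = 0 := by
          intro v hv hvt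
          have hvt' : v ∉ t := fun h => hvt (Finset.mem_inter.2 ⟨hv, h⟩)
          have := h v
          rwa [if_pos hv, if_neg hvt'] at this
        rw [← Finset.coe_inter, Finset.mem_convexHull']
        refine ⟨w, fun v hv => hw v (Finset.mem_inter.1 hv).1, ?_, ?_⟩
        · rw [← hw1]
          exact Finset.sum_subset Finset.inter_subset_left hoff
        · rw [← hwx]
          exact Finset.sum_subset Finset.inter_subset_left fun v hv hvt => by
            rw [hoff v hv hvt, zero_smul] }
  refine ⟨K, ?_, Set.Subset.antisymm ?_ ?_⟩
  · refine (Finset.finite_toSet hVfin.toFinset.powerset).subset fun s hs => ?_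
    rw [Finset.mem_coe, Finset.mem_powerset]
    exact fun v hv => hVfin.mem_toFinset.2 (hs.2.1 hv)
  · intro x hx
    obtain ⟨s, hs, hxs⟩ := Geometry.SimplicialComplex.mem_space_iff.1 hx
    obtain ⟨q, hq, htop⟩ := hs.2.2.exists_top hs.1
    exact hP q (hs.2.1 hq).1 x (convexHull_min (fun v hv => htop v hv) (convex_setOf_cellLE q) hxs)
  · intro x hx
    obtain ⟨s, hsne, hsV, hschain, hxs, -⟩ :=
      exists_chain_mem_convexHull hb hP hc hcc _ x hx le_rfl
    exact Geometry.SimplicialComplex.mem_space_iff.2 ⟨s, ⟨hsne, fun v hv => hsV v hv, hschain⟩, hxs⟩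

end Cells

/-- A convex polytope is the solution set of finitely many affine inequalities, by Weyl's theorem
for the cone over the polytope at height `1`. -/
lemma exists_affineMaps_convexHull {E : Type*} [AddCommGroup E] [Module ℝ E]
    [FiniteDimensional ℝ E] (s : Finset E) :
    ∃ G : Finset (E →ᵃ[ℝ] ℝ), convexHull ℝ (s : Set E) = {x | ∀ g ∈ G, g x ≤ 0} := by
  classical
  obtain ⟨L, hL⟩ := exists_finset_dual_finCone (s.image fun v => (v, (1 : ℝ)))
  refine ⟨L.image fun l => (l ∘ₗ LinearMap.inl ℝ E ℝ).toAffineMap +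
    AffineMap.const ℝ E (l (0, 1)), ?_⟩
  have hinj : Function.Injective fun v : E => (v, (1 : ℝ)) := fun v w h => (Prod.ext_iff.1 h).1
  have hcone : ∀ x, x ∈ convexHull ℝ (s : Set E) ↔
      (x, (1 : ℝ)) ∈ finCone (s.image fun v => (v, (1 : ℝ))) := by
    intro x
    rw [Finset.mem_convexHull']
    constructor
    · rintro ⟨w, hw, hw1, hwx⟩
      refine ⟨fun q => w q.1, by simpa using hw, ?_⟩
      rw [Finset.sum_image hinj.injOn]
      ext
      · simpa [Prod.fst_sum] using hwx
      · simpa [Prod.snd_sum] using hw1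
    · rintro ⟨w, hw, h⟩
      rw [Finset.sum_image hinj.injOn] at h
      refine ⟨fun v => w (v, 1), fun v hv => hw _ (Finset.mem_image_of_mem _ hv), ?_, ?_⟩
      · simpa [Prod.snd_sum] using congrArg Prod.snd h
      · simpa [Prod.fst_sum] using congrArg Prod.fst h
  ext x
  rw [hcone, hL]
  simp only [Set.mem_ofPred_eq, Finset.forall_mem_image]
  refine forall₂_congr fun l _ => ?_
  have : l (x, 1) = l (x, 0) + l (0, 1) := by
    rw [← map_add, Prod.mk_add_mk, add_zero, zero_add]
  rw [this]
  simp

lemma exists_isTriangulation {n : ℕ} {P : Set (Euc n)} (hP : P ∈ polyhedra n) :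
    ∃ K : Geometry.SimplicialComplex ℝ (Euc n), IsTriangulation K P := by
  classical
  obtain ⟨F, hF, hFp, rfl⟩ := hP
  have hex : ∀ Q : F, ∃ G : Finset (Euc n →ᵃ[ℝ] ℝ), (Q : Set (Euc n)) = {x | ∀ g ∈ G, g x ≤ 0} := by
    rintro ⟨Q, hQ⟩
    obtain ⟨V, hV, rfl⟩ := hFp hQ
    obtain ⟨G, hG⟩ := exists_affineMaps_convexHull hV.toFinset
    exact ⟨G, by rw [← hG, hV.coe_toFinset]⟩
  choose G hG using hex
  have : Finite F := hF
  refine exists_simplicialComplex_of_cells (ι := Σ Q : F, G Q) (fun i => (i.2 : Euc n →ᵃ[ℝ] ℝ))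
    ?_ ?_
  · refine (Bornology.isBounded_sUnion hF).2 fun Q hQ => ?_
    obtain ⟨V, hV, rfl⟩ := hFp hQ
    exact (hV.isCompact_convexHull (𝕜 := ℝ)).isBounded
  · rintro x ⟨Q, hQ, hxQ⟩ y hyx
    refine ⟨Q, hQ, ?_⟩
    have h := hG ⟨Q, hQ⟩
    simp only at h
    rw [h] at hxQ ⊢
    intro g hg
    rcases hyx ⟨⟨Q, hQ⟩, ⟨g, hg⟩⟩ with h0 | h0
    · exact le_of_eq h0
    · rw [← sign_nonpos_iff]
      exact h0.trans_le (sign_nonpos_iff.2 (hxQ g hg))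

/-! ### Euler characteristics of complexes as sums over closed simplices -/

section FaceCoefficients

variable {α : Type*} [DecidableEq α]

/-- The coefficients in the expression of the indicator of a simplicial complex by indicators of
its closed simplices, obtained by Möbius inversion in the face poset. -/
def faceCoeff (𝓕 : Finset (Finset α)) (s : Finset α) : ℝ :=
  ∑ q ∈ 𝓕 with s ⊆ q, (-1 : ℝ) ^ (q.card + s.card)

lemma sum_Icc_neg_one_pow_card {r q : Finset α} (h : r ⊆ q) :
    ∑ s ∈ Finset.Icc r q, (-1 : ℝ) ^ (q.card + s.card) = if r = q then 1 else 0 := by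
  rw [Finset.Icc_eq_image_powerset h, Finset.sum_image]
  · have h1 : ∀ u ∈ (q \ r).powerset, (-1 : ℝ) ^ (q.card + (r ∪ u).card)
        = (-1 : ℝ) ^ (q.card + r.card) * ((-1 : ℤ) ^ u.card : ℤ) := by
      intro u hu
      have hd : Disjoint r u :=
        Finset.disjoint_of_subset_right (Finset.mem_powerset.1 hu) Finset.disjoint_sdiff
      rw [Finset.card_union_of_disjoint hd, ← add_assoc, pow_add]
      push_cast
      rfl
    rw [Finset.sum_congr rfl h1, ← Finset.mul_sum, ← Int.cast_sum,
      Finset.sum_powerset_neg_one_pow_card]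
    by_cases hrq : r = q
    · subst hrq
      simp [← two_mul]
    · rw [if_neg hrq, if_neg, Int.cast_zero, mul_zero]
      exact fun h' => hrq (h.antisymm (Finset.sdiff_eq_empty_iff_subset.1 h'))
  · intro u hu v hv huv
    rw [Finset.mem_coe, Finset.mem_powerset] at hu hv
    have hu' : Disjoint r u := Finset.disjoint_of_subset_right hu Finset.disjoint_sdiff
    have hv' : Disjoint r v := Finset.disjoint_of_subset_right hv Finset.disjoint_sdiff
    dsimp only at huv
    rw [← Finset.union_sdiff_cancel_left hu', huv, Finset.union_sdiff_cancel_left hv']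

lemma sum_faceCoeff_of_subset {𝓕 : Finset (Finset α)} {r : Finset α} (hr : r ∈ 𝓕)
    (h𝓕 : ∀ q ∈ 𝓕, ∀ s, r ⊆ s → s ⊆ q → s ∈ 𝓕) :
    ∑ s ∈ 𝓕 with r ⊆ s, faceCoeff 𝓕 s = 1 := by
  simp only [faceCoeff]
  rw [Finset.sum_comm' (t' := 𝓕.filter fun q => r ⊆ q) (s' := fun q => Finset.Icc r q)]
  · rw [Finset.sum_congr rfl fun q hq => sum_Icc_neg_one_pow_card (Finset.mem_filter.1 hq).2,
      Finset.sum_ite_eq, if_pos (Finset.mem_filter.2 ⟨hr, subset_rfl⟩)]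
  · intro s q
    simp only [Finset.mem_filter, Finset.mem_Icc]
    constructor
    · rintro ⟨⟨_, hrs⟩, hq, hsq⟩
      exact ⟨⟨hrs, hsq⟩, hq, subset_trans hrs hsq⟩
    · rintro ⟨⟨hrs, hsq⟩, hq, _⟩
      exact ⟨⟨h𝓕 q hq s hrs hsq, hrs⟩, hq, hsq⟩

lemma sum_faceCoeff {𝓕 : Finset (Finset α)} (hne : ∀ s ∈ 𝓕, s.Nonempty)
    (h𝓕 : ∀ q ∈ 𝓕, ∀ s ⊆ q, s.Nonempty → s ∈ 𝓕) :
    ∑ s ∈ 𝓕, faceCoeff 𝓕 s = ∑ s ∈ 𝓕, (-1 : ℝ) ^ (s.card + 1) := by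
  have h1 : ∀ s ∈ 𝓕, ∑ r ∈ 𝓕 with r ⊆ s, (-1 : ℝ) ^ (r.card + 1) = 1 := by
    intro s hs
    have h2 : (𝓕.filter fun r => r ⊆ s) = s.powerset.erase ∅ := by
      ext r
      rw [Finset.mem_filter, Finset.mem_erase, Finset.mem_powerset]
      exact ⟨fun h => ⟨(hne r h.1).ne_empty, h.2⟩,
        fun h => ⟨h𝓕 s hs r h.2 (Finset.nonempty_iff_ne_empty.2 h.1), h.2⟩⟩
    have h3 := Finset.sum_powerset_neg_one_pow_card_of_nonempty (hne s hs)
    rw [← Finset.add_sum_erase _ _ (Finset.empty_mem_powerset s), Finset.card_empty, pow_zero] at h3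
    have h4 : (∑ r ∈ s.powerset.erase ∅, (-1 : ℝ) ^ r.card) = -1 := by
      have := congrArg (Int.cast : ℤ → ℝ) h3
      push_cast at this
      linarith
    rw [h2]
    simp only [pow_succ, mul_neg_one]
    rw [Finset.sum_neg_distrib, h4, neg_neg]
  have h5 : ∀ s ∈ 𝓕, faceCoeff 𝓕 s
      = ∑ r ∈ 𝓕 with r ⊆ s, (-1 : ℝ) ^ (r.card + 1) * faceCoeff 𝓕 s := fun s hs => by
    rw [← Finset.sum_mul, h1 s hs, one_mul]
  rw [Finset.sum_congr rfl h5, Finset.sum_comm' (t' := 𝓕) (s' := fun r => 𝓕.filter fun s => r ⊆ s)]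
  · refine Finset.sum_congr rfl fun r hr => ?_
    rw [← Finset.mul_sum, sum_faceCoeff_of_subset hr fun q hq s hrs hsq =>
      h𝓕 q hq s hsq ((hne r hr).mono hrs), mul_one]
  · intro s r
    simp only [Finset.mem_filter]
    tauto

/-- Among the faces that contain `x` there is a smallest one `r`, so that the faces that contain
`x` are those that contain `r`. -/
lemma sum_indicator_faceCoeff {E : Type*} [AddCommGroup E] [Module ℝ E] [DecidableEq E]
    (K : Geometry.SimplicialComplex ℝ E) (hK : K.faces.Finite) (x : E) :
    ∑ s ∈ hK.toFinset, (convexHull ℝ (s : Set E)).indicator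
      (fun _ => faceCoeff hK.toFinset s) x = K.space.indicator 1 x := by
  classical
  by_cases hx : x ∈ K.space
  · obtain ⟨s₀, hs₀, hxs₀⟩ := Geometry.SimplicialComplex.mem_space_iff.1 hx
    obtain ⟨r, hr, hmin⟩ := Finset.exists_min_image
      (hK.toFinset.filter fun s : Finset E => x ∈ convexHull ℝ (s : Set E)) Finset.card
      ⟨s₀, by simp [hs₀, hxs₀]⟩
    rw [Finset.mem_filter, hK.mem_toFinset] at hr
    have hiff : ∀ s ∈ hK.toFinset, x ∈ convexHull ℝ (s : Set E) ↔ r ⊆ s := by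
      intro s hs
      rw [hK.mem_toFinset] at hs
      refine ⟨fun hxs => ?_, fun hrs => convexHull_mono (by simpa using hrs) hr.2⟩
      have hxi : x ∈ convexHull ℝ ((r ∩ s : Finset E) : Set E) := by
        rw [Finset.coe_inter]
        exact K.inter_subset_convexHull hr.1 hs ⟨hr.2, hxs⟩
      have hne : (r ∩ s).Nonempty := by
        rw [← Finset.coe_nonempty, ← convexHull_nonempty_iff (𝕜 := ℝ)]
        exact ⟨x, hxi⟩
      have hle := hmin (r ∩ s) (by
        rw [Finset.mem_filter, hK.mem_toFinset]
        exact ⟨K.down_closed hr.1 Finset.inter_subset_left hne, hxi⟩)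
      exact Finset.inter_eq_left.1 (Finset.eq_of_subset_of_card_le Finset.inter_subset_left hle)
    rw [Set.indicator_of_mem hx, Pi.one_apply,
      ← sum_faceCoeff_of_subset (hK.mem_toFinset.2 hr.1) (𝓕 := hK.toFinset), Finset.sum_filter]
    · refine Finset.sum_congr rfl fun s hs => ?_
      rw [Set.indicator_apply]
      exact if_congr (hiff s hs) rfl rfl
    · intro q hq s hrs hsq
      rw [hK.mem_toFinset] at hq ⊢
      exact K.down_closed hq hsq ((K.nonempty_of_mem_faces hr.1).mono hrs)
  · rw [Set.indicator_of_notMem hx]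
    refine Finset.sum_eq_zero fun s hs => Set.indicator_of_notMem (fun hxs => hx ?_) _
    exact K.convexHull_subset_space (hK.mem_toFinset.1 hs) hxs

end FaceCoefficients

/-! ### Tangent cones and normal cones -/

section TangentCones

variable {n : ℕ}

lemma segment_add_smul_subset {x v : Euc n} {t t' : ℝ} (ht' : 0 ≤ t') (h : t' ≤ t) :
    segment ℝ x (x + t' • v) ⊆ segment ℝ x (x + t • v) := by
  refine (convex_segment x _).segment_subset (left_mem_segment ℝ _ _) ?_
  rcases ht'.eq_or_lt with rfl | hpos
  · simpa using left_mem_segment ℝ x (x + t • v)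
  · have ht : 0 < t := hpos.trans_le h
    rw [segment_eq_image']
    refine ⟨t' / t, ⟨by positivity, (div_le_one ht).2 h⟩, ?_⟩
    simp only [add_sub_cancel_left, smul_smul]
    rw [div_mul_cancel₀ _ ht.ne']

lemma tanCone_mono {P Q : Set (Euc n)} (h : P ⊆ Q) (x : Euc n) : tanCone P x ⊆ tanCone Q x :=
  fun _ ⟨t, ht, hs⟩ => ⟨t, ht, hs.trans h⟩

lemma eventually_add_smul_mem {N : Set (Euc n)} {x : Euc n} (hN : N ∈ nhds x) (v : Euc n) :
    ∀ᶠ t in nhdsWithin (0 : ℝ) (Set.Ioi 0), x + t • v ∈ N := by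
  have h : Filter.Tendsto (fun t : ℝ => x + t • v) (nhds 0) (nhds x) := by
    have : Continuous fun t : ℝ => x + t • v := by fun_prop
    simpa using this.tendsto 0
  exact nhdsWithin_le_nhds (h hN)

lemma tanCone_subset_of_inter_eq {P Q N : Set (Euc n)} {x : Euc n} (hN : N ∈ nhds x)
    (h : P ∩ N = Q ∩ N) : tanCone P x ⊆ tanCone Q x := by
  rintro v ⟨t, ht, hs⟩
  obtain ⟨ε, hε, hball⟩ := Metric.mem_nhds_iff.1 hN
  have hev : ∀ᶠ t' in nhdsWithin (0 : ℝ) (Set.Ioi 0),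
      x + t' • v ∈ Metric.ball x ε ∧ t' ≤ t ∧ 0 < t' :=
    (eventually_add_smul_mem (Metric.ball_mem_nhds x hε) v).and
      (Filter.Eventually.and (nhdsWithin_le_nhds (Iic_mem_nhds ht)) self_mem_nhdsWithin)
  obtain ⟨t', hb, hle, hpos⟩ := hev.exists
  refine ⟨t', hpos, fun y hy => ?_⟩
  have hyN : y ∈ N :=
    hball ((convex_ball x ε).segment_subset (Metric.mem_ball_self hε) hb hy)
  have hyP : y ∈ P := hs (segment_add_smul_subset hpos.le hle hy)
  exact (h.subset ⟨hyP, hyN⟩).1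

lemma eventually_add_smul_mem_of_mem_tanCone {P : Set (Euc n)} {x v : Euc n}
    (h : v ∈ tanCone P x) : ∀ᶠ t in nhdsWithin (0 : ℝ) (Set.Ioi 0), x + t • v ∈ P := by
  obtain ⟨t, ht, hs⟩ := h
  filter_upwards [self_mem_nhdsWithin, nhdsWithin_le_nhds (Iic_mem_nhds ht)] with t' ht' hle
  exact hs (segment_add_smul_subset (le_of_lt ht') hle (right_mem_segment ℝ _ _))

/-- Near `x`, a closed convex set agrees with its tangent cone along each ray from `x`, and it is
missed by the ray if it does not contain `x`. -/
lemma eventually_add_smul_mem_iff {Q : Set (Euc n)} (hconv : Convex ℝ Q) (hclosed : IsClosed Q)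
    (x v : Euc n) : ∀ᶠ t in nhdsWithin (0 : ℝ) (Set.Ioi 0),
      x + t • v ∈ Q ↔ x ∈ Q ∧ v ∈ tanCone Q x := by
  by_cases hx : x ∈ Q
  · by_cases hv : v ∈ tanCone Q x
    · filter_upwards [eventually_add_smul_mem_of_mem_tanCone hv] with t ht
      exact iff_of_true ht ⟨hx, hv⟩
    · filter_upwards [self_mem_nhdsWithin] with t ht
      exact iff_of_false (fun h => hv ⟨t, ht, hconv.segment_subset hx h⟩) fun h => hv h.2
  · filter_upwards [eventually_add_smul_mem (hclosed.isOpen_compl.mem_nhds hx) v] with t ht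
    exact iff_of_false ht fun h => hx h.1

variable {ι : Type*}

lemma mem_tanCone_biUnion {I : Finset ι} {Q : ι → Set (Euc n)}
    (hconv : ∀ i ∈ I, Convex ℝ (Q i)) (hclosed : ∀ i ∈ I, IsClosed (Q i)) {x v : Euc n} :
    v ∈ tanCone (⋃ i ∈ I, Q i) x ↔ ∃ i ∈ I, x ∈ Q i ∧ v ∈ tanCone (Q i) x := by
  constructor
  · intro hv
    obtain ⟨t, ht, hiff⟩ := ((eventually_add_smul_mem_of_mem_tanCone hv).and
      ((Filter.eventually_all_finset I).2 fun i hi =>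
        eventually_add_smul_mem_iff (hconv i hi) (hclosed i hi) x v)).exists
    obtain ⟨i, hi, hti⟩ := Set.mem_iUnion₂.1 ht
    exact ⟨i, hi, (hiff i hi).1 hti⟩
  · rintro ⟨i, hi, -, hv⟩
    exact tanCone_mono (Set.subset_biUnion_of_mem (u := Q) hi) x hv

open Classical in
/-- Linear relations between indicators pass to tangent cones: the value at `v` of the indicator of
a tangent cone at `x` is the value of the indicator of the set at `x + t • v` for small `t`. -/
lemma indicator_tanCone_eq_sum {I : Finset ι} {Q : ι → Set (Euc n)}
    (hconv : ∀ i ∈ I, Convex ℝ (Q i)) (hclosed : ∀ i ∈ I, IsClosed (Q i)) {c : ι → ℝ}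
    (h : ∀ y, ∑ i ∈ I, (Q i).indicator (fun _ => c i) y = (⋃ i ∈ I, Q i).indicator 1 y)
    (x : Euc n) :
    (tanCone (⋃ i ∈ I, Q i) x).indicator 1
      = ∑ i ∈ I with x ∈ Q i, c i • (tanCone (Q i) x).indicator (1 : Euc n → ℝ) := by
  ext v
  obtain ⟨t, hiff⟩ := ((Filter.eventually_all_finset I).2 fun i hi =>
    eventually_add_smul_mem_iff (hconv i hi) (hclosed i hi) x v).exists
  have h1 : x + t • v ∈ ⋃ i ∈ I, Q i ↔ v ∈ tanCone (⋃ i ∈ I, Q i) x := by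
    rw [mem_tanCone_biUnion hconv hclosed, Set.mem_iUnion₂]
    simp only [exists_prop]
    exact exists_congr fun i => and_congr_right fun hi => hiff i hi
  have h2 : (tanCone (⋃ i ∈ I, Q i) x).indicator (1 : Euc n → ℝ) v
      = (⋃ i ∈ I, Q i).indicator 1 (x + t • v) := by
    rw [Set.indicator_apply, Set.indicator_apply]
    exact if_congr h1.symm rfl rfl
  rw [h2, ← h, Finset.sum_apply, Finset.sum_filter]
  refine Finset.sum_congr rfl fun i hi => ?_
  rw [Set.indicator_apply, if_congr (hiff i hi) rfl rfl, Pi.smul_apply, Set.indicator_apply,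
    ite_and]
  simp

/-- The normal cone of the polytope `convexHull ℝ s` at `x`. -/
def normalCone (s : Finset (Euc n)) (x : Euc n) : Set (Euc n) :=
  {u | ∀ v ∈ s, inner ℝ u (v - x) ≤ 0}

lemma normalCone_eq [DecidableEq (Euc n)] (s : Finset (Euc n)) (x : Euc n) :
    normalCone s x = {u | ∀ w ∈ s.image fun v => v - x, inner ℝ u w ≤ 0} := by
  simp [normalCone]

lemma normalCone_mem_polyhedralCones (s : Finset (Euc n)) (x : Euc n) :
    normalCone s x ∈ polyhedralCones n := by
  classical
  rw [normalCone_eq]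
  exact setOf_inner_nonpos_mem_polyhedralCones _

lemma tanCone_convexHull [DecidableEq (Euc n)] (s : Finset (Euc n)) {x : Euc n}
    (hx : x ∈ convexHull ℝ (s : Set (Euc n))) :
    tanCone (convexHull ℝ (s : Set (Euc n))) x = finCone (s.image fun v => v - x) := by
  have hinj : Set.InjOn (fun v : Euc n => v - x) s := fun v _ w _ h => sub_left_injective h
  ext y
  constructor
  · rintro ⟨t, ht, hs⟩
    obtain ⟨w, hw, hw1, hwx⟩ := Finset.mem_convexHull'.1 (hs (right_mem_segment ℝ _ _))
    refine ⟨fun z => t⁻¹ * w (z + x), ?_, ?_⟩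
    · intro z hz
      obtain ⟨v, hv, rfl⟩ := Finset.mem_image.1 hz
      dsimp only
      rw [sub_add_cancel]
      exact mul_nonneg (by positivity) (hw v hv)
    · rw [Finset.sum_image hinj]
      simp only [sub_add_cancel, mul_smul, smul_sub]
      rw [Finset.sum_sub_distrib, ← Finset.smul_sum, ← Finset.smul_sum, hwx, ← Finset.sum_smul,
        hw1, one_smul, smul_add, smul_smul, inv_mul_cancel₀ ht.ne', one_smul, add_sub_cancel_left]
  · rintro ⟨c, hc, rfl⟩
    rw [Finset.sum_image hinj]
    obtain ⟨l, hl, hl1, hlx⟩ := Finset.mem_convexHull'.1 hx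
    have hc' : ∀ v ∈ s, 0 ≤ c (v - x) := fun v hv => hc _ (Finset.mem_image_of_mem _ hv)
    set M := ∑ v ∈ s, c (v - x) with hM
    have hM0 : 0 ≤ M := Finset.sum_nonneg hc'
    have hM1 : 0 < 1 + M := by linarith
    have hr : 1 - (1 + M)⁻¹ * M = (1 + M)⁻¹ := by
      field_simp
      ring
    refine ⟨(1 + M)⁻¹, by positivity, (convex_convexHull ℝ _).segment_subset hx ?_⟩
    rw [Finset.mem_convexHull']
    refine ⟨fun v => (1 + M)⁻¹ * (l v + c (v - x)), fun v hv =>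
      mul_nonneg (by positivity) (add_nonneg (hl v hv) (hc' v hv)), ?_, ?_⟩
    · rw [← Finset.mul_sum, Finset.sum_add_distrib, hl1, ← hM, inv_mul_cancel₀ hM1.ne']
    · simp only [mul_smul, add_smul, smul_sub]
      rw [← Finset.smul_sum, Finset.sum_add_distrib, hlx, Finset.sum_sub_distrib,
        ← Finset.sum_smul, ← hM, smul_add, smul_sub, smul_smul]
      nth_rewrite 1 [← hr]
      rw [sub_smul, one_smul]
      abel

lemma dualCone_tanCone_convexHull (s : Finset (Euc n)) {x : Euc n}
    (hx : x ∈ convexHull ℝ (s : Set (Euc n))) :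
    dualCone (tanCone (convexHull ℝ (s : Set (Euc n))) x) = normalCone s x := by
  classical
  rw [tanCone_convexHull s hx, dualCone_finCone, normalCone_eq]

lemma tanCone_convexHull_mem_polyhedralCones (s : Finset (Euc n)) {x : Euc n}
    (hx : x ∈ convexHull ℝ (s : Set (Euc n))) :
    tanCone (convexHull ℝ (s : Set (Euc n))) x ∈ polyhedralCones n := by
  classical
  rw [tanCone_convexHull s hx]
  exact finCone_mem_polyhedralCones _

variable {φ : Set (Euc n) → ℝ}

/-- At a point of a polytope other than a vertex, the normal cone is orthogonal to a nonzero
vector. -/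
lemma IsSimple.normalCone_eq_zero (hsimple : IsSimple n φ) {s : Finset (Euc n)} {x : Euc n}
    (hx : x ∈ convexHull ℝ (s : Set (Euc n))) (hxs : x ∉ s) : φ (normalCone s x) = 0 := by
  obtain ⟨l, hl, hl1, hlx⟩ := Finset.mem_convexHull'.1 hx
  obtain ⟨v, hv, hlv⟩ : ∃ v ∈ s, l v ≠ 0 := by
    by_contra! hcon
    rw [Finset.sum_eq_zero hcon] at hl1
    exact zero_ne_one hl1
  refine hsimple.eq_zero_of_subset_hyperplane (normalCone_mem_polyhedralCones s x)
    (sub_ne_zero.2 (ne_of_mem_of_not_mem hv hxs)) fun u hu => ?_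
  have hsum : ∑ w ∈ s, l w * inner ℝ u (w - x) = 0 := by
    have h0 : ∑ w ∈ s, l w • (w - x) = 0 := by
      simp only [smul_sub]
      rw [Finset.sum_sub_distrib, hlx, ← Finset.sum_smul, hl1, one_smul, sub_self]
    rw [← inner_zero_right (𝕜 := ℝ) u, ← h0, inner_sum]
    exact Finset.sum_congr rfl fun w _ => (real_inner_smul_right _ _ _).symm
  rw [Finset.sum_eq_zero_iff_of_nonpos fun w hw =>
    mul_nonpos_of_nonneg_of_nonpos (hl w hw) (hu w hw)] at hsum
  exact (mul_eq_zero.1 (hsum v hv)).resolve_left hlv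

/-- The normal cones at the vertices of a polytope tile the space: a generic linear functional has
a unique maximum point. -/
lemma IsValuationOn.sum_normalCone (hval : IsValuationOn (polyhedralCones n) φ)
    (hsimple : IsSimple n φ) (hnorm : φ Set.univ = 1) {s : Finset (Euc n)} (hs : s.Nonempty) :
    ∑ v ∈ s, φ (normalCone s v) = 1 := by
  classical
  have h := hval.sum_eq_zero_of_generic hsimple (Finset.insertNone s)
    (fun o => o.elim (-1) fun _ => 1) (fun o => o.elim Set.univ (normalCone s)) ?_
    (s.offDiag.image fun q => q.1 - q.2) ?_ ?_
  · rw [Finset.sum_insertNone] at h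
    simp only [Option.elim, hnorm, one_mul, mul_one] at h
    linarith
  · rintro (_ | v) -
    · simpa using setOf_inner_nonpos_mem_polyhedralCones (∅ : Finset (Euc n))
    · exact normalCone_mem_polyhedralCones s v
  · intro w hw
    obtain ⟨⟨v, v'⟩, hq, rfl⟩ := Finset.mem_image.1 hw
    exact sub_ne_zero.2 (Finset.mem_offDiag.1 hq).2.2
  · intro u hu
    obtain ⟨m, hm, hmax⟩ := s.exists_max_image (fun v => inner ℝ u v) hs
    have hmem : ∀ v ∈ s, u ∈ normalCone s v ↔ v = m := by
      intro v hv
      refine ⟨fun h => ?_, ?_⟩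
      · by_contra hne
        refine hu (v - m) (Finset.mem_image.2 ⟨(v, m), Finset.mem_offDiag.2 ⟨hv, hm, hne⟩, rfl⟩) ?_
        have h1 := h m hm
        have h2 := hmax v hv
        rw [inner_sub_right] at h1 ⊢
        linarith
      · rintro rfl w hw
        rw [inner_sub_right]
        linarith [hmax w hw]
    rw [Finset.sum_insertNone]
    simp only [Option.elim]
    have h1 : ∑ v ∈ s, (normalCone s v).indicator (fun _ => (1 : ℝ)) u
        = ∑ v ∈ s, if v = m then 1 else 0 :=
      Finset.sum_congr rfl fun v hv => by
        rw [Set.indicator_apply]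
        exact if_congr (hmem v hv) rfl rfl
    rw [h1, Finset.sum_ite_eq' s m, if_pos hm, Set.indicator_univ]
    norm_num

end TangentCones

/-! ### Vertex curvature -/

section Curvature

variable {n : ℕ} {φ ψ : Set (Euc n) → ℝ}

open Classical in
/-- In a triangulated polyhedron, the curvature at a point is a combination of the values of `φ` at
the normal cones of the simplices of which the point is a vertex. -/
lemma vertexCurvature_eq_sum (hval : IsValuationOn (polyhedralCones n) φ)
    (hsimple : IsSimple n φ)
    (hψ : IsAdditiveExtension (polyhedralCones n) (dualValuation φ) ψ)
    (K : Geometry.SimplicialComplex ℝ (Euc n)) (hK : K.faces.Finite) (x : Euc n) :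
    vertexCurvature ψ K.space x =
      ∑ s ∈ hK.toFinset with x ∈ s, faceCoeff hK.toFinset s * φ (normalCone s x) := by
  have hspace : K.space = ⋃ s ∈ hK.toFinset, convexHull ℝ (s : Set (Euc n)) := by
    simp [Geometry.SimplicialComplex.space]
  have hconv : ∀ s ∈ hK.toFinset, Convex ℝ (convexHull ℝ (s : Set (Euc n))) :=
    fun s _ => convex_convexHull ℝ _
  have hclosed : ∀ s ∈ hK.toFinset, IsClosed (convexHull ℝ (s : Set (Euc n))) :=
    fun s _ => s.finite_toSet.isClosed_convexHull ℝ
  rw [vertexCurvature]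
  split_ifs with hx
  · obtain ⟨Λ, hΛ⟩ := hval.exists_linearMap_dualValuation hsimple
    have hmem : tanCone K.space x ∈ finiteUnions (polyhedralCones n) := by
      refine ⟨(fun s : Finset (Euc n) => tanCone (convexHull ℝ (s : Set (Euc n))) x) ''
        (hK.toFinset.filter fun s => x ∈ convexHull ℝ (s : Set (Euc n)) : Finset (Finset (Euc n))),
        (Finset.finite_toSet _).image _, ?_, ?_⟩
      · rintro _ ⟨s, hs, rfl⟩
        exact tanCone_convexHull_mem_polyhedralCones s (Finset.mem_filter.1 hs).2
      · ext v
        rw [hspace, mem_tanCone_biUnion hconv hclosed]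
        simp only [Set.mem_sUnion, Set.exists_mem_image, Finset.mem_coe, Finset.mem_filter,
          and_assoc]
    rw [hψ.eq_linearMap (fun A hA B hB => inter_mem_polyhedralCones hA hB) Λ hΛ hmem, hspace,
      indicator_tanCone_eq_sum hconv hclosed (c := faceCoeff hK.toFinset)
        (fun y => by rw [← hspace]; exact sum_indicator_faceCoeff K hK y) x, map_sum,
      Finset.sum_filter, Finset.sum_filter]
    refine Finset.sum_congr rfl fun s _ => ?_
    by_cases hxs : x ∈ convexHull ℝ (s : Set (Euc n))
    · rw [if_pos hxs, map_smul, smul_eq_mul,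
        hΛ _ (tanCone_convexHull_mem_polyhedralCones s hxs), dualValuation,
        dualCone_tanCone_convexHull s hxs]
      split_ifs with hxv
      · rfl
      · rw [hsimple.normalCone_eq_zero hxs hxv, mul_zero]
    · rw [if_neg hxs, if_neg fun h : x ∈ s => hxs (subset_convexHull ℝ _ h)]
  · rw [Finset.filter_false_of_mem, Finset.sum_empty]
    exact fun s hs hxs => hx (K.subset_space (hK.mem_toFinset.1 hs) hxs)

lemma vertexCurvature_support_subset (hval : IsValuationOn (polyhedralCones n) φ)
    (hsimple : IsSimple n φ)
    (hψ : IsAdditiveExtension (polyhedralCones n) (dualValuation φ) ψ)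
    (K : Geometry.SimplicialComplex ℝ (Euc n)) (hK : K.faces.Finite) {x : Euc n}
    (hx : vertexCurvature ψ K.space x ≠ 0) : ∃ s ∈ K.faces, x ∈ s := by
  classical
  rw [vertexCurvature_eq_sum hval hsimple hψ K hK] at hx
  obtain ⟨s, hs, -⟩ := Finset.exists_ne_zero_of_sum_ne_zero hx
  rw [Finset.mem_filter, hK.mem_toFinset] at hs
  exact ⟨s, hs⟩

lemma finsum_vertexCurvature (hval : IsValuationOn (polyhedralCones n) φ)
    (hsimple : IsSimple n φ) (hnorm : φ Set.univ = 1)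
    (hψ : IsAdditiveExtension (polyhedralCones n) (dualValuation φ) ψ)
    (K : Geometry.SimplicialComplex ℝ (Euc n)) (hK : K.faces.Finite) :
    ∑ᶠ x ∈ K.space, vertexCurvature ψ K.space x = (complexEulerChar K : ℝ) := by
  classical
  set V : Finset (Euc n) := hK.toFinset.biUnion id with hV
  have hmemV : ∀ x, x ∈ V ↔ ∃ s ∈ K.faces, x ∈ s := by
    intro x
    rw [hV, Finset.mem_biUnion]
    simp only [hK.mem_toFinset, id]
  have h1 : ∑ᶠ x ∈ K.space, vertexCurvature ψ K.space x
      = ∑ x ∈ V, vertexCurvature ψ K.space x := by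
    refine finsum_mem_eq_sum_of_inter_support_eq _ ?_
    ext x
    simp only [Set.mem_inter_iff, Function.mem_support, Finset.mem_coe]
    refine ⟨fun h => ⟨(hmemV x).2 (vertexCurvature_support_subset hval hsimple hψ K hK h.2), h.2⟩,
      fun h => ⟨?_, h.2⟩⟩
    obtain ⟨s, hs, hxs⟩ := (hmemV x).1 h.1
    exact K.subset_space hs hxs
  have h2 : (complexEulerChar K : ℝ) = ∑ s ∈ hK.toFinset, (-1 : ℝ) ^ (s.card + 1) := by
    rw [complexEulerChar, finsum_mem_eq_finite_toFinset_sum _ hK]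
    push_cast
    rfl
  rw [h1, h2, ← sum_faceCoeff (fun s hs => K.nonempty_of_mem_faces (hK.mem_toFinset.1 hs))
    (fun q hq s hsq hs => hK.mem_toFinset.2 (K.down_closed (hK.mem_toFinset.1 hq) hsq hs)),
    Finset.sum_congr rfl fun x _ => vertexCurvature_eq_sum hval hsimple hψ K hK x,
    Finset.sum_comm' (t' := hK.toFinset) (s' := fun s => s)]
  · refine Finset.sum_congr rfl fun s hs => ?_
    rw [← Finset.mul_sum, hval.sum_normalCone hsimple hnorm
      (K.nonempty_of_mem_faces (hK.mem_toFinset.1 hs)), mul_one]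
  · intro x s
    rw [Finset.mem_filter]
    refine ⟨fun h => ⟨h.2.2, h.2.1⟩, fun h => ⟨?_, h.2, h.1⟩⟩
    exact (hmemV x).2 ⟨s, hK.mem_toFinset.1 h.2, h.1⟩

end Curvature

theorem theorem1 (n : ℕ) (φ : Set (Euc n) → ℝ)
    (hval : IsValuationOn (polyhedralCones n) φ)
    (hsimple : IsSimple n φ)
    (hnorm : φ Set.univ = 1) :
    (∃ ψ : Set (Euc n) → ℝ, IsAdditiveExtension (polyhedralCones n) (dualValuation φ) ψ) ∧
    ∀ ψ : Set (Euc n) → ℝ, IsAdditiveExtension (polyhedralCones n) (dualValuation φ) ψ →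
      IsPolyhedralVertexCurvature n (vertexCurvature ψ) := by
  obtain ⟨Λ, hΛ⟩ := hval.exists_linearMap_dualValuation hsimple
  refine ⟨⟨_, isAdditiveExtension_of_linearMap Λ hΛ⟩, fun ψ hψ => ⟨?_, ?_, ?_⟩⟩
  · intro x N hN P _ Q _ hPQ
    have hx : x ∈ P ↔ x ∈ Q := by
      have hxN := mem_of_mem_nhds hN
      exact ⟨fun h => (hPQ.subset ⟨h, hxN⟩).1, fun h => (hPQ.symm.subset ⟨h, hxN⟩).1⟩
    have htan : tanCone P x = tanCone Q x :=
      (tanCone_subset_of_inter_eq hN hPQ).antisymm (tanCone_subset_of_inter_eq hN hPQ.symm)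
    rw [vertexCurvature, vertexCurvature, htan]
    by_cases h : x ∈ P
    · rw [if_pos h, if_pos (hx.1 h)]
    · rw [if_neg h, if_neg fun h' => h (hx.2 h')]
  · intro P hP
    obtain ⟨K, hK, rfl⟩ := exists_isTriangulation hP
    refine (hK.biUnion fun s _ => s.finite_toSet).subset fun x hx => ?_
    obtain ⟨s, hs, hxs⟩ := vertexCurvature_support_subset hval hsimple hψ K hK hx.2
    exact Set.mem_biUnion hs hxs
  · intro P hP
    refine ⟨exists_isTriangulation hP, ?_⟩
    rintro K ⟨hK, rfl⟩
    exact finsum_vertexCurvature hval hsimple hnorm hψ K hK
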